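/- A HEDG $G=(V,E,H)$ consists of a finite set $V$ of nodes, a set $E\subseteq V\times V$ of directed edges (cycles and self-loops are allowed) and a simplicial complex $H$ over $V$ that contains all singletons; $v\leftrightarrow w$ means that $v\ne w$ and $\{v,w\}\in H$. $\mathrm{Anc}^G(B)$ and $\mathrm{Desc}^G(B)$ are the ancestors and descendants of $B\subseteq V$ along directed paths (including $B$), $\mathrm{Sc}^G(v)=\mathrm{Anc}^G(v)\cap\mathrm{Desc}^G(v)$ and $\mathrm{NonDesc}^G(v)=V\setminus\mathrm{Desc}^G(v)$. A set $A\subseteq V$ is ancestral in $G$ if $\mathrm{Anc}^G(A)=A$, and then carries the induced sub-HEDG structure (all edges and hyperedges inside $A$). The marginalization $G^{\setminus U}$, $U\subseteq V$, has nodes $V\setminus U$; edges $v\to w$ whenever there is a directed path $v\to u_1\to\dots\to u_r\to w$ in $G$, $r\ge 0$, with all $u_i\in U$; and as hyperedges those $F'\subseteq V\setminus U$ for which there is $F\in H$ with $F\subseteq F'\cup U$ such that every $v\in F'$ lies in $F\setminus U$ or is the end of a directed path $u_1\to\dots\to u_r\to v$, $r\ge1$, with all $u_i\in U$ and $u_1\in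 F$. The moralization $G^{\mathrm{mor}}$ is the undirected graph on $V$ in which distinct $v,w$ are adjacent iff there are $v_1\leftrightarrow\dots\leftrightarrow v_n$ ($n\ge1$) with $v=v_1$ or $v\to v_1$, and $w=v_n$ or $w\to v_n$; $\partial_{G^{\mathrm{mor}}}(v)$ is the set of neighbours of $v$. A path in $G$ is a finite sequence of $n\ge 1$ nodes, repetitions allowed, with a directed (in either direction) or bidirected edge chosen between consecutive nodes. It is blocked by $Z$ if an endnode is in $Z$, or some inner node is a collider (both adjacent edges have an arrowhead at it) not in $\mathrm{Anc}^G(Z)$, or is a non-collider in $Z$; $X$ is d-separated from $Y$ given $Z$ if every path between $X$ and $Y$ is blocked by $Z$. Let $<$ be a total order on $V$ and let $\mathrm{Pred}_\le(v)=\{w: w\le v\}$ carry the structure of the marginalization of $G$ with respect to the other nodes. The order $<$ is - topological if $w\to v$ implies $w<v$; - pseudo-topological if $w<v$ for all $v\in V$ and $w\in\mathrm{Anc}^G(v)\setminus\mathrm{Sc}^G(v)$; - assembling if $v'\in\mathrm{Sc}^G(v)$ and $v\le w\le v'$ imply $w\in\mathrm{Sc}^G(v)$; - a perfect elimination order if for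 every $v\in V$ and every ancestral sub-HEDG $A$ of $\mathrm{Pred}_\le(v)$ with $v\in A$ the set $\partial_{A^{\mathrm{mor}}}(v)\cup\{v\}$ is complete in $A^{\mathrm{mor}}$; - quasi-topological if it is pseudo-topological and a perfect elimination order. For a ternary relation $X\perp Y\mid Z$ on subsets of $V$ consider the following properties. - dGMP: if $X$ is d-separated from $Y$ given $Z$ in $G$, then $X\perp Y\mid Z$, for all $X,Y,Z\subseteq V$. - oLMP (with respect to $<$): $\{v\}\perp A\setminus\{v\}\mid\partial_{A^{\mathrm{mor}}}(v)$ for every $v\in V$ and every ancestral sub-HEDG $A$ of $\mathrm{Pred}_\le(v)$ with $v\in A$. - dLMP: $\{v\}\perp (A\setminus S)\setminus\{v\}\mid\partial_{(A^{\setminus S})^{\mathrm{mor}}}(v)$ for every $v\in V$, every ancestral sub-HEDG $A\subseteq\mathrm{NonDesc}^G(v)\cup\mathrm{Sc}^G(v)$ of $G$ with $v\in A$ and every $S\subseteq\mathrm{Sc}^G(v)\setminus\{v\}$. **Theorem.** Let $G$ be a HEDG with a total order $<$ on $V$, let $\mathcal X_v$, $v\in V$, be standard Borel spaces, let $P_V$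 be a probability distribution on $\prod_{v\in V}\mathcal X_v$, and let $X\perp Y\mid Z$ mean that the tuples of coordinates $(T_v)_{v\in X}$ and $(T_v)_{v\in Y}$ are conditionally independent given $(T_v)_{v\in Z}$ under $P_V$. 1. If $<$ is a perfect elimination order of $G$, then oLMP implies dGMP. 2. If $<$ is an assembling quasi-topological order of $G$, then oLMP, dLMP and dGMP are equivalent. 3. Every topological order of $G$ is an assembling quasi-topological order, so 2. applies to it. 4. Statements 1. and 2. depend only on the semi-graphoid axioms: they hold for every ternary relation on subsets of $V$ such that for all $X,Y,W,Z\subseteq V$: (i) $X\perp Y\mid Y$; (ii) $X\perp Y\mid Z$ implies $Y\perp X\mid Z$; (iii) $X\perp Y\cup W\mid Z$ implies $X\perp Y\mid Z$; (iv) $X\perp Y\cup W\mid Z$ implies $X\perp Y\mid W\cup Z$; (v) $X\perp Y\mid W\cup Z$ and $X\perp W\mid Z$ imply $X\perp Y\cup W\mid Z$. -/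

import Mathlib

open Set MeasureTheory ProbabilityTheory

/-- A directed graph with hyperedges: a set of nodes, a set of directed edges between nodes
(cycles and self-loops are allowed), and a simplicial complex of hyperedges over the nodes.
The nodes form a subset of an ambient type, so that sub-graphs and marginalizations of a graph live
over the same ambient type. -/
structure HEDG (V : Type*) where
  nodes : Set V
  E : V → V → Prop
  H : Set (Set V)
  E_nodes : ∀ ⦃v w⦄, E v w → v ∈ nodes ∧ w ∈ nodes
  H_nodes : ∀ ⦃F⦄, F ∈ H → F ⊆ nodes
  H_singleton : ∀ ⦃v⦄, v ∈ nodes → {v} ∈ H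
  H_down : ∀ ⦃F F'⦄, F ∈ H → F' ⊆ F → F' ∈ H

/-- The three kinds of edges in a path, read from left to right: `→`, `←`, `↔`. -/
inductive EdgeKind
  | right
  | left
  | bi

/-- The edge has an arrowhead at its right end. -/
def EdgeKind.HeadRight : EdgeKind → Prop
  | .right => True
  | .left => False
  | .bi => True

/-- The edge has an arrowhead at its left end. -/
def EdgeKind.HeadLeft : EdgeKind → Prop
  | .right => False
  | .left => True
  | .bi => True

namespace HEDG

variable {V : Type*}

/-- Parents of a set of nodes. -/
def Pa (G : HEDG V) (A : Set V) : Set V := {v | ∃ w ∈ A, G.E v w}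

/-- Children of a set of nodes. -/
def Ch (G : HEDG V) (A : Set V) : Set V := {w | ∃ v ∈ A, G.E v w}

/-- Ancestors of a set of nodes; every node is an ancestor of itself. -/
def Anc (G : HEDG V) (A : Set V) : Set V :=
  {v | v ∈ G.nodes ∧ ∃ w ∈ A, Relation.ReflTransGen G.E v w}

/-- Descendants of a set of nodes; every node is a descendant of itself. -/
def Desc (G : HEDG V) (A : Set V) : Set V :=
  {w | w ∈ G.nodes ∧ ∃ v ∈ A, Relation.ReflTransGen G.E v w}

/-- Non-descendants of a node. -/
def NonDesc (G : HEDG V) (v : V) : Set V := G.nodes \ G.Desc {v}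

/-- The strongly connected component of a node. -/
def Sc (G : HEDG V) (v : V) : Set V := G.Anc {v} ∩ G.Desc {v}

/-- The bidirected edge `v ↔ w`. -/
def Bidir (G : HEDG V) (v w : V) : Prop := v ≠ w ∧ {v, w} ∈ G.H

/-- The union of the districts of the nodes in `A`. -/
def Dist (G : HEDG V) (A : Set V) : Set V :=
  {w | w ∈ G.nodes ∧ ∃ v ∈ A, Relation.ReflTransGen G.Bidir v w}

/-- The induced sub-HEDG on (the nodes in) `A`. -/
def sub (G : HEDG V) (A : Set V) : HEDG V where
  nodes := G.nodes ∩ A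
  E v w := G.E v w ∧ v ∈ A ∧ w ∈ A
  H := {F | F ∈ G.H ∧ F ⊆ A}
  E_nodes _ _ h := ⟨⟨(G.E_nodes h.1).1, h.2.1⟩, ⟨(G.E_nodes h.1).2, h.2.2⟩⟩
  H_nodes _ h := subset_inter (G.H_nodes h.1) h.2
  H_singleton _ h := ⟨G.H_singleton h.1, singleton_subset_iff.2 h.2⟩
  H_down _ _ h h' := ⟨G.H_down h.1 h', h'.trans h.2⟩

/-- There is a directed path `v → u₁ → ⋯ → uᵣ → w` with `r ≥ 0` and all `uᵢ ∈ U`. -/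
def DirVia (G : HEDG V) (U : Set V) (v w : V) : Prop :=
  ∃ u, Relation.ReflTransGen (fun a b => G.E a b ∧ b ∈ U) v u ∧ G.E u w

/-- The marginalization of `G` with respect to `U` (the nodes in `U` are marginalized out). -/
def marg (G : HEDG V) (U : Set V) : HEDG V where
  nodes := G.nodes \ U
  E v w := v ∈ G.nodes \ U ∧ w ∈ G.nodes \ U ∧ G.DirVia U v w
  H := {F' | F' ⊆ G.nodes \ U ∧ ∃ F ∈ G.H, F ⊆ F' ∪ U ∧
    ∀ v ∈ F', v ∈ F \ U ∨ ∃ u ∈ F ∩ U, G.DirVia U u v}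
  E_nodes _ _ h := ⟨h.1, h.2.1⟩
  H_nodes _ h := h.1
  H_singleton v h := ⟨singleton_subset_iff.2 h, {v}, G.H_singleton h.1, subset_union_left,
    fun w hw => Or.inl ⟨hw, by rw [mem_singleton_iff.1 hw]; exact h.2⟩⟩
  H_down F' F'' h h' := by
    obtain ⟨h1, F, hF, -, h3⟩ := h
    refine ⟨h'.trans h1, F ∩ (F'' ∪ U), G.H_down hF inter_subset_left, inter_subset_right, ?_⟩
    intro v hv
    rcases h3 v (h' hv) with h | ⟨u, hu, huv⟩
    · exact Or.inl ⟨⟨h.1, Or.inl hv⟩, h.2⟩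
    · exact Or.inr ⟨u, ⟨⟨hu.1, Or.inr hu.2⟩, hu.2⟩, huv⟩

/-- `A` is (the node set of) an ancestral sub-HEDG of `G`. -/
def IsAncestral (G : HEDG V) (A : Set V) : Prop := A ⊆ G.nodes ∧ G.Anc A = A

/-- The generalized moralization, an undirected graph. Nodes outside of `G.nodes` are isolated. -/
def moral (G : HEDG V) : SimpleGraph V where
  Adj v w := v ≠ w ∧ v ∈ G.nodes ∧ w ∈ G.nodes ∧ ∃ a b,
    (v = a ∨ G.E v a) ∧ (w = b ∨ G.E w b) ∧ Relation.ReflTransGen G.Bidir a b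
  symm := ⟨by
    rintro v w ⟨hne, hv, hw, a, b, ha, hb, hab⟩
    refine ⟨hne.symm, hw, hv, b, a, hb, ha, ?_⟩
    have hs : Std.Symm G.Bidir :=
      ⟨fun x y h => ⟨h.1.symm, by rw [Set.pair_comm]; exact h.2⟩⟩
    exact Relation.ReflTransGen.stdSymm.symm _ _ hab⟩
  loopless := ⟨fun _ h => h.1 rfl⟩

/-- The Markov blanket of `v` in the moralization of `G`: all neighbours of `v`. -/
def blanket (G : HEDG V) (v : V) : Set V := G.moral.neighborSet v

/-- The Markov blanket in terms of districts, parents and children. -/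
theorem blanket_eq (G : HEDG V) {v : V} (hv : v ∈ G.nodes) :
    G.blanket v =
      (G.Dist ({v} ∪ G.Ch {v}) ∪ G.Pa (G.Dist ({v} ∪ G.Ch {v}))) \ {v} := by
  have hnode : ∀ {a b}, Relation.ReflTransGen G.Bidir a b → a ∈ G.nodes → b ∈ G.nodes := by
    intro a b h ha
    induction h with
    | refl => exact ha
    | tail _ h _ => exact G.H_nodes h.2 (by simp)
  ext w
  constructor
  · rintro ⟨hne, -, hw, a, b, ha, hb, hab⟩
    have haN : a ∈ G.nodes := by
      rcases ha with rfl | ha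
      · exact hv
      · exact (G.E_nodes ha).2
    have hbD : b ∈ G.Dist ({v} ∪ G.Ch {v}) := by
      refine ⟨hnode hab haN, a, ?_, hab⟩
      rcases ha with rfl | ha
      · exact Or.inl rfl
      · exact Or.inr ⟨v, rfl, ha⟩
    refine ⟨?_, fun h => hne (mem_singleton_iff.1 h).symm⟩
    rcases hb with rfl | hb
    · exact Or.inl hbD
    · exact Or.inr ⟨b, hbD, hb⟩
  · rintro ⟨h, hne⟩
    have key : ∀ b ∈ G.Dist ({v} ∪ G.Ch {v}), ∃ a, (v = a ∨ G.E v a) ∧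
        Relation.ReflTransGen G.Bidir a b := by
      rintro b ⟨-, a, ha, hab⟩
      refine ⟨a, ?_, hab⟩
      rcases ha with ha | ⟨x, hx, hxa⟩
      · exact Or.inl (mem_singleton_iff.1 ha).symm
      · rw [mem_singleton_iff.1 hx] at hxa
        exact Or.inr hxa
    rcases h with h | ⟨b, hb, hwb⟩
    · obtain ⟨a, ha, hab⟩ := key w h
      exact ⟨fun e => hne e.symm, hv, h.1, a, w, ha, Or.inl rfl, hab⟩
    · obtain ⟨a, ha, hab⟩ := key b hb
      exact ⟨fun e => hne e.symm, hv, (G.E_nodes hwb).1, a, b, ha, Or.inr hwb, hab⟩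

/-- There is an edge of the given kind from `v` (on the left) to `w` (on the right). -/
def Edge (G : HEDG V) : EdgeKind → V → V → Prop
  | .right, v, w => G.E v w
  | .left, v, w => G.E w v
  | .bi, v, w => G.Bidir v w

/-- Paths in `G`: sequences of at least one node, possibly repeated, together with a choice of a
directed or bidirected edge between any two consecutive nodes. -/
inductive Path (G : HEDG V) : V → V → Type _
  | nil (v : V) (hv : v ∈ G.nodes) : Path G v v
  | cons {u v w : V} (k : EdgeKind) (h : G.Edge k u v) (p : Path G v w) : Path G u w

/-- Some inner node of the path is a collider outside of `Anc(Z)` or a non-collider in `Z`. -/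
def Path.InnerBlocked {G : HEDG V} (Z : Set V) : {x y : V} → G.Path x y → Prop
  | _, _, .nil _ _ => False
  | _, _, .cons _ _ (.nil _ _) => False
  | _, _, .cons k _ (.cons (u := v) k' h' p) =>
      ((k.HeadRight ∧ k'.HeadLeft) ∧ v ∉ G.Anc Z) ∨
      (¬ (k.HeadRight ∧ k'.HeadLeft) ∧ v ∈ Z) ∨
      Path.InnerBlocked Z (.cons k' h' p)

/-- The path is blocked by `Z`. -/
def Path.Blocked {G : HEDG V} (Z : Set V) {x y : V} (p : G.Path x y) : Prop :=
  x ∈ Z ∨ y ∈ Z ∨ p.InnerBlocked Z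

/-- `X` is d-separated from `Y` given `Z` in `G`. -/
def DSep (G : HEDG V) (X Y Z : Set V) : Prop :=
  ∀ x ∈ X, ∀ y ∈ Y, ∀ p : G.Path x y, p.Blocked Z

section Order

variable [LinearOrder V]

/-- The predecessors of `v` (including `v`), with the marginalized structure. -/
def pred (G : HEDG V) (v : V) : HEDG V := G.marg {w | v < w}

/-- The order is a topological order of `G`. -/
def IsTopological (G : HEDG V) : Prop := ∀ v ∈ G.nodes, ∀ w ∈ G.Pa {v}, w < v

/-- The order is a pseudo-topological order of `G`. -/
def IsPseudoTopological (G : HEDG V) : Prop :=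
  ∀ v ∈ G.nodes, ∀ w ∈ G.Anc {v} \ G.Sc v, w < v

/-- The order is assembling. -/
def IsAssembling (G : HEDG V) : Prop :=
  ∀ v ∈ G.nodes, ∀ v' ∈ G.nodes, ∀ w ∈ G.nodes,
    v' ∈ G.Sc v → v ≤ w → w ≤ v' → w ∈ G.Sc v

/-- The order is a perfect elimination order of `G`. -/
def IsPerfectElimination (G : HEDG V) : Prop :=
  ∀ v ∈ G.nodes, ∀ A : Set V, (G.pred v).IsAncestral A → v ∈ A →
    ((G.pred v).sub A).moral.IsClique (((G.pred v).sub A).blanket v ∪ {v})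

/-- The order is a quasi-topological order of `G`. -/
def IsQuasiTopological (G : HEDG V) : Prop :=
  G.IsPseudoTopological ∧ G.IsPerfectElimination

/-- The ordered local Markov property for the ternary (independence) relation `I`. -/
def OLMP (G : HEDG V) (I : Set V → Set V → Set V → Prop) : Prop :=
  ∀ v ∈ G.nodes, ∀ A : Set V, (G.pred v).IsAncestral A → v ∈ A →
    I {v} (A \ {v}) (((G.pred v).sub A).blanket v)

end Order

/-- The directed global Markov property for the ternary (independence) relation `I`. -/
def DGMP (G : HEDG V) (I : Set V → Set V → Set V → Prop) : Prop :=
  ∀ X Y Z : Set V, X ⊆ G.nodes → Y ⊆ G.nodes → Z ⊆ G.nodes → G.DSep X Y Z → I X Y Z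

/-- The directed local Markov property for the ternary (independence) relation `I`. -/
def DLMP (G : HEDG V) (I : Set V → Set V → Set V → Prop) : Prop :=
  ∀ v ∈ G.nodes, ∀ A : Set V, G.IsAncestral A → A ⊆ G.NonDesc v ∪ G.Sc v → v ∈ A →
    ∀ S ⊆ G.Sc v \ {v},
      I {v} ((A \ S) \ {v}) (((G.sub A).marg S).blanket v)

end HEDG

/-- The semi-graphoid axioms for a ternary relation `I X Y Z` on subsets of `V`. -/
structure IsSemigraphoid {V : Type*} (I : Set V → Set V → Set V → Prop) : Prop where
  irrelevance : ∀ X Y, I X Y Y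
  symmetry : ∀ X Y Z, I X Y Z → I Y X Z
  decomposition : ∀ X Y W Z, I X (Y ∪ W) Z → I X Y Z
  weak_union : ∀ X Y W Z, I X (Y ∪ W) Z → I X Y (W ∪ Z)
  contraction : ∀ X Y W Z, I X Y (W ∪ Z) → I X W Z → I X (Y ∪ W) Z

/-- Conditional independence of the tuples of coordinate projections indexed by `X` and by `Y` given
the tuple indexed by `Z`, under a probability distribution `P` on the product space. -/
def CondIndepCoord {V : Type*} [Finite V] {𝓧 : V → Type*} [∀ v, MeasurableSpace (𝓧 v)]
    [∀ v, StandardBorelSpace (𝓧 v)] (P : Measure (∀ v, 𝓧 v)) [IsProbabilityMeasure P]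
    (X Y Z : Set V) : Prop :=
  CondIndepFun
    (MeasurableSpace.comap (fun (x : ∀ v, 𝓧 v) (v : Z) => x v) inferInstance)
    (Measurable.comap_le (measurable_pi_lambda _ fun _ => measurable_pi_apply _))
    (fun (x : ∀ v, 𝓧 v) (v : X) => x v) (fun (x : ∀ v, 𝓧 v) (v : Y) => x v) P

/-! The two structures in the local properties, an ancestral part of the predecessors of `v` and an
ancestral part of `G` with `S` marginalized out, are both marginalizations `G.onto B` of `G` itself
(`IsAncestral.sub_marg_eq_onto`, `marg_sub_eq_onto`). Distinct nodes of `B` are adjacent in the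
moralization of `G.onto B` exactly when a walk in `G` joins them whose inner colliders are ancestors
of `B` and whose inner non-colliders lie outside `B` (the `Reach` lemmas and
`exists_openWalk_of_adj`). Hence Markov blankets d-separate (`dSep_blanket`), deleting a node joins
at most its neighbours (`adj_or_adj_of_adj_sdiff`), and d-separation becomes separation in the
moralization of the ancestors (`DSep.exists_partition`).

For oLMP to dGMP, such a separation is turned into independence by deleting the largest node `v`
repeatedly (`OLMP.of_separation`). In a perfect elimination order the neighbours of `v` are already
adjacent to each other, so the deletion preserves the separation; the independence of `v` given by
oLMP is then glued on by contraction. The step from dGMP to dLMP is `dSep_blanket`. For dLMP to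
oLMP, an assembling pseudo-topological order makes an ancestral part of the predecessors of `v` an
ancestral set of `G` minus the later nodes of `G.Sc v`.

Probability enters only through the semi-graphoid axioms. -/

/-! ### Conditional independence of σ-algebras -/

section CondIndep

variable {Ω : Type*}

/-- The intersections `s ∩ t` form a π-system generating `m₁ ⊔ m₂`, and the sets with equal
integrals form a Dynkin system. -/
theorem setIntegral_eq_of_sup {m₁ m₂ mΩ : MeasurableSpace Ω} (h₁ : m₁ ≤ mΩ) (h₂ : m₂ ≤ mΩ)
    {μ : Measure Ω} [IsFiniteMeasure μ] {f g : Ω → ℝ} (hf : Integrable f μ) (hg : Integrable g μ)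
    (h : ∀ s t, MeasurableSet[m₁] s → MeasurableSet[m₂] t →
      ∫ x in s ∩ t, f x ∂μ = ∫ x in s ∩ t, g x ∂μ)
    {s : Set Ω} (hs : MeasurableSet[m₁ ⊔ m₂] s) : ∫ x in s, f x ∂μ = ∫ x in s, g x ∂μ := by
  have hgen : m₁ ⊔ m₂ =
      MeasurableSpace.generateFrom {u | ∃ s t, MeasurableSet[m₁] s ∧ MeasurableSet[m₂] t ∧
        s ∩ t = u} := by
    refine le_antisymm (sup_le ?_ ?_) (MeasurableSpace.generateFrom_le ?_)
    · intro s hs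
      exact MeasurableSpace.measurableSet_generateFrom
        ⟨s, univ, hs, MeasurableSet.univ, inter_univ s⟩
    · intro s hs
      exact MeasurableSpace.measurableSet_generateFrom
        ⟨univ, s, MeasurableSet.univ, hs, univ_inter s⟩
    · rintro _ ⟨s, t, hs, ht, rfl⟩
      exact MeasurableSet.inter ((le_sup_left : m₁ ≤ m₁ ⊔ m₂) s hs)
        ((le_sup_right : m₂ ≤ m₁ ⊔ m₂) t ht)
  have hle : m₁ ⊔ m₂ ≤ mΩ := sup_le h₁ h₂
  have huniv : ∫ x, f x ∂μ = ∫ x, g x ∂μ := by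
    simpa using h univ univ MeasurableSet.univ MeasurableSet.univ
  induction s, hs using MeasurableSpace.induction_on_inter hgen with
  | h_inter =>
    rintro _ ⟨s, t, hs, ht, rfl⟩ _ ⟨s', t', hs', ht', rfl⟩ -
    exact ⟨s ∩ s', t ∩ t', hs.inter hs', ht.inter ht', inter_inter_inter_comm _ _ _ _⟩
  | empty => simp
  | basic u hu =>
    obtain ⟨s, t, hs, ht, rfl⟩ := hu
    exact h s t hs ht
  | compl t ht ih =>
    have e1 := integral_add_compl (mX := mΩ) (hle t ht) hf
    have e2 := integral_add_compl (mX := mΩ) (hle t ht) hg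
    linarith
  | iUnion u hd hu ih =>
    rw [integral_iUnion (fun i => hle _ (hu i)) hd hf.integrableOn,
      integral_iUnion (fun i => hle _ (hu i)) hd hg.integrableOn]
    exact tsum_congr ih

theorem integrable_indicator_one {mΩ : MeasurableSpace Ω} {μ : Measure Ω} [IsFiniteMeasure μ] {s : Set Ω}
    (hs : MeasurableSet s) : Integrable (s.indicator fun _ => (1 : ℝ)) μ :=
  (integrable_indicator_iff hs).2 integrableOn_const

/-- Conditional independence as an equality of conditional probabilities. -/
theorem condIndep_iff_condExp_sup_eq {m' m₁ m₂ mΩ : MeasurableSpace Ω} [StandardBorelSpace Ω] (hm' : m' ≤ mΩ)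
    (hm₁ : m₁ ≤ mΩ) (hm₂ : m₂ ≤ mΩ) (μ : Measure Ω) [IsFiniteMeasure μ] :
    CondIndep m' m₁ m₂ hm' μ ↔
      ∀ t, MeasurableSet[m₁] t → μ⟦t | m₂ ⊔ m'⟧ =ᵐ[μ] μ⟦t | m'⟧ := by
  have hsup : m₂ ⊔ m' ≤ mΩ := sup_le hm₂ hm'
  have hmul : ∀ (s : Set Ω) (f : Ω → ℝ), s.indicator f = f * s.indicator fun _ => (1 : ℝ) := by
    intro s f
    ext x
    by_cases hx : x ∈ s <;> simp [hx]
  -- The factor `μ⟦t₁ | m'⟧` is `m'`-measurable and can be pulled out.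
  have hcomb : ∀ (t₁ t₂ : Set Ω), MeasurableSet t₁ → MeasurableSet t₂ →
      μ[t₂.indicator (μ⟦t₁ | m'⟧) | m'] =ᵐ[μ] μ⟦t₁ | m'⟧ * μ⟦t₂ | m'⟧ := by
    intro t₁ t₂ h₁ h₂
    rw [hmul]
    exact condExp_mul_of_stronglyMeasurable_left stronglyMeasurable_condExp
      (by rw [← hmul]; exact integrable_condExp.indicator h₂) (integrable_indicator_one h₂)
  have hint : ∀ (t₁ t₂ : Set Ω), ((t₁ ∩ t₂).indicator fun _ => (1 : ℝ)) =
      t₂.indicator (t₁.indicator fun _ => (1 : ℝ)) := by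
    intro t₁ t₂
    rw [indicator_indicator, inter_comm]
  rw [condIndep_iff m' m₁ m₂ hm' hm₁ hm₂ μ]
  constructor
  · intro h t₁ ht₁
    refine (ae_eq_condExp_of_forall_setIntegral_eq hsup (integrable_indicator_one (hm₁ _ ht₁))
      (fun s _ _ => integrable_condExp.integrableOn) (fun s hs _ => ?_)
      ((stronglyMeasurable_condExp (m := m')).mono
        (le_sup_right : m' ≤ m₂ ⊔ m')).aestronglyMeasurable).symm
    refine setIntegral_eq_of_sup hm₂ hm' integrable_condExp
      (integrable_indicator_one (hm₁ _ ht₁)) (fun t₂ z ht₂ hz => ?_) hs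
    have hz' := hm' _ hz
    have ht₂' := hm₂ _ ht₂
    rw [inter_comm, ← setIntegral_indicator ht₂', ← setIntegral_indicator ht₂', ← hint,
      ← setIntegral_condExp hm' (integrable_condExp.indicator ht₂') hz,
      ← setIntegral_condExp hm' (integrable_indicator_one ((hm₁ _ ht₁).inter ht₂')) hz]
    refine setIntegral_congr_ae hz' ?_
    filter_upwards [hcomb t₁ t₂ (hm₁ _ ht₁) ht₂', h t₁ t₂ ht₁ ht₂] with x h1 h2 _
    rw [h1, h2]
  · intro h t₁ t₂ ht₁ ht₂
    have ht₁' := hm₁ _ ht₁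
    have ht₂' := hm₂ _ ht₂
    -- Tower property through `m₂ ⊔ m'`, over which the indicator of `t₂` pulls out.
    refine (condExp_condExp_of_le (le_sup_right : m' ≤ m₂ ⊔ m') hsup).symm.trans
      (Filter.EventuallyEq.trans (condExp_congr_ae ?_) (hcomb t₁ t₂ ht₁' ht₂'))
    rw [hint]
    refine (condExp_indicator (integrable_indicator_one ht₁')
      ((le_sup_left : m₂ ≤ m₂ ⊔ m') _ ht₂)).trans ?_
    filter_upwards [h t₁ ht₁] with x hx
    by_cases hx2 : x ∈ t₂ <;> simp [hx2, hx]

end CondIndep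

/-! ### Coordinates of a product space form a semi-graphoid -/

section Coordinates

variable {V : Type*} {𝓧 : V → Type*} [∀ v, MeasurableSpace (𝓧 v)]

/-- The σ-algebra generated by the coordinates in `X`. -/
abbrev coordSigma (𝓧 : V → Type*) [∀ v, MeasurableSpace (𝓧 v)] (X : Set V) :
    MeasurableSpace (∀ v, 𝓧 v) :=
  MeasurableSpace.comap (fun (x : ∀ v, 𝓧 v) (v : X) => x v) inferInstance

theorem coordSigma_le (X : Set V) : coordSigma 𝓧 X ≤ MeasurableSpace.pi :=
  Measurable.comap_le (measurable_pi_lambda _ fun _ => measurable_pi_apply _)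

theorem coordSigma_eq_iSup (X : Set V) : coordSigma 𝓧 X =
    ⨆ v ∈ X, MeasurableSpace.comap (fun x : ∀ v, 𝓧 v => x v) inferInstance := by
  rw [coordSigma, MeasurableSpace.pi, MeasurableSpace.comap_iSup, iSup_subtype]
  simp only [MeasurableSpace.comap_comp, Function.comp_def]

theorem coordSigma_union (X Y : Set V) :
    coordSigma 𝓧 (X ∪ Y) = coordSigma 𝓧 X ⊔ coordSigma 𝓧 Y := by
  simp only [coordSigma_eq_iSup, iSup_union]

variable [Finite V] [∀ v, StandardBorelSpace (𝓧 v)]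

theorem condIndepCoord_iff (P : Measure (∀ v, 𝓧 v)) [IsProbabilityMeasure P] (X Y Z : Set V) :
    CondIndepCoord P X Y Z ↔ ∀ t, MeasurableSet[coordSigma 𝓧 X] t →
      P⟦t | coordSigma 𝓧 (Y ∪ Z)⟧ =ᵐ[P] P⟦t | coordSigma 𝓧 Z⟧ := by
  rw [CondIndepCoord, condIndepFun_iff_condIndep,
    condIndep_iff_condExp_sup_eq _ (coordSigma_le X) (coordSigma_le Y), coordSigma_union]

/-- Independence says that conditioning on `Y ∪ Z` gives the same as conditioning on `Z`.
Contraction is then transitivity of equality; decomposition and weak union follow by conditioning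
the given equality on an intermediate σ-algebra, for which its right-hand side is already
measurable. -/
theorem isSemigraphoid_condIndepCoord (P : Measure (∀ v, 𝓧 v)) [IsProbabilityMeasure P] :
    IsSemigraphoid (CondIndepCoord P) where
  irrelevance X Y := by
    rw [condIndepCoord_iff]
    intro t _
    rw [union_self]
  symmetry X Y Z h := CondIndepFun.symm h
  decomposition X Y W Z h := by
    rw [condIndepCoord_iff] at h ⊢
    intro t ht
    have hle : coordSigma 𝓧 (Y ∪ Z) ≤ coordSigma 𝓧 (Y ∪ W ∪ Z) := by
      rw [union_right_comm, coordSigma_union (Y ∪ Z)]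
      exact le_sup_left
    have hle' : coordSigma 𝓧 Z ≤ coordSigma 𝓧 (Y ∪ Z) := by
      rw [coordSigma_union]
      exact le_sup_right
    refine (condExp_condExp_of_le hle (coordSigma_le _)).symm.trans
      ((condExp_congr_ae (h t ht)).trans ?_)
    rw [condExp_of_stronglyMeasurable (coordSigma_le _)
      (stronglyMeasurable_condExp.mono hle') integrable_condExp]
  weak_union X Y W Z h := by
    rw [condIndepCoord_iff] at h ⊢
    intro t ht
    have hle : coordSigma 𝓧 (W ∪ Z) ≤ coordSigma 𝓧 (Y ∪ W ∪ Z) := by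
      rw [union_assoc, coordSigma_union Y]
      exact le_sup_right
    have hle' : coordSigma 𝓧 Z ≤ coordSigma 𝓧 (W ∪ Z) := by
      rw [coordSigma_union]
      exact le_sup_right
    rw [← union_assoc]
    refine (h t ht).trans (Filter.EventuallyEq.symm ?_)
    refine (condExp_condExp_of_le hle (coordSigma_le _)).symm.trans
      ((condExp_congr_ae (h t ht)).trans ?_)
    rw [condExp_of_stronglyMeasurable (coordSigma_le _)
      (stronglyMeasurable_condExp.mono hle') integrable_condExp]
  contraction X Y W Z h h' := by
    rw [condIndepCoord_iff] at h h' ⊢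
    intro t ht
    rw [union_assoc]
    exact (h t ht).trans (h' t ht)

end Coordinates

/-! ### Ancestors and bidirected edges -/

namespace HEDG

variable {V : Type*} {G : HEDG V}

theorem bidir_symm {x y : V} (h : G.Bidir x y) : G.Bidir y x :=
  ⟨h.1.symm, by rw [Set.pair_comm]; exact h.2⟩

theorem reflTransGen_bidir_symm {x y : V} (h : Relation.ReflTransGen G.Bidir x y) :
    Relation.ReflTransGen G.Bidir y x := by
  have hs : Std.Symm G.Bidir := ⟨fun _ _ => bidir_symm⟩
  exact Relation.ReflTransGen.stdSymm.symm _ _ h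

theorem mem_anc_of_E {C : Set V} {x y : V} (h : G.E x y) (hy : y ∈ G.Anc C) : x ∈ G.Anc C := by
  obtain ⟨-, c, hc, hyc⟩ := hy
  exact ⟨(G.E_nodes h).1, c, hc, hyc.head h⟩

theorem mem_anc_of_reflTransGen {C : Set V} {x y : V} (h : Relation.ReflTransGen G.E x y)
    (hy : y ∈ G.Anc C) : x ∈ G.Anc C := by
  induction h using Relation.ReflTransGen.head_induction_on with
  | refl => exact hy
  | head h _ ih => exact mem_anc_of_E h ih

theorem anc_mono {C C' : Set V} (h : C ⊆ C') : G.Anc C ⊆ G.Anc C' :=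
  fun _ ⟨hx, c, hc, hxc⟩ => ⟨hx, c, h hc, hxc⟩

/-! ### Directed paths through a set -/

theorem DirVia.of_E {U : Set V} {x y : V} (h : G.E x y) : G.DirVia U x y := ⟨x, .refl, h⟩

theorem DirVia.trans_E {U : Set V} {x u y : V} (h : G.DirVia U x u) (hu : u ∈ U) (e : G.E u y) :
    G.DirVia U x y := by
  obtain ⟨t, ht, e'⟩ := h
  exact ⟨u, ht.tail ⟨e', hu⟩, e⟩

theorem DirVia.trans {U : Set V} {x u y : V} (h : G.DirVia U x u) (hu : u ∈ U)
    (h' : G.DirVia U u y) : G.DirVia U x y := by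
  obtain ⟨t, ht, e⟩ := h
  obtain ⟨t', ht', e'⟩ := h'
  exact ⟨t', (ht.tail ⟨e, hu⟩).trans ht', e'⟩

theorem DirVia.reflTransGen {U : Set V} {x y : V} (h : G.DirVia U x y) :
    Relation.ReflTransGen G.E x y := by
  obtain ⟨t, ht, e⟩ := h
  exact (Relation.ReflTransGen.mono (fun _ _ h => h.1) _ _ ht).tail e

/-- Splitting off the first edge of a directed path through `U`. -/
theorem DirVia.head_cases {U : Set V} {x y : V} (h : G.DirVia U x y) :
    G.E x y ∨ ∃ u ∈ U, G.E x u ∧ G.DirVia U u y := by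
  obtain ⟨t, ht, e⟩ := h
  rcases Relation.ReflTransGen.cases_head ht with rfl | ⟨u, ⟨hu, huU⟩, hut⟩
  · exact Or.inl e
  · exact Or.inr ⟨u, huU, hu, t, hut, e⟩

/-- A directed path through `U` ending in `A` only visits ancestors of `A`. -/
theorem DirVia.restrict {U W A : Set V} {x y : V} (hy : y ∈ A) (hW : U ∩ G.Anc A ⊆ W)
    (h : G.DirVia U x y) : G.DirVia W x y := by
  obtain ⟨t, ht, e⟩ := h
  have htA : t ∈ G.Anc A := ⟨(G.E_nodes e).1, y, hy, .single e⟩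
  refine ⟨t, ?_, e⟩
  clear e
  induction ht with
  | refl => exact .refl
  | tail _ h ih => exact (ih (mem_anc_of_E h.1 htA)).tail ⟨h.1, hW ⟨h.2, htA⟩⟩

/-- The nodes in `U` are skipped along a directed path in the marginalization. -/
theorem reflTransGen_marg {U : Set V} {x y : V} (h : Relation.ReflTransGen G.E x y)
    (hx : x ∉ U) (hy : y ∉ U) : Relation.ReflTransGen (G.marg U).E x y := by
  suffices H : ∀ z, Relation.ReflTransGen G.E z y →
      (z ∉ U → Relation.ReflTransGen (G.marg U).E z y) ∧
      (z ∈ U → ∃ u, u ∈ G.nodes \ U ∧ G.DirVia U z u ∧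
        Relation.ReflTransGen (G.marg U).E u y) from (H x h).1 hx
  intro z hz
  induction hz using Relation.ReflTransGen.head_induction_on with
  | refl => exact ⟨fun _ => .refl, fun h => absurd h hy⟩
  | @head z w e _ ih =>
    have hn := G.E_nodes e
    by_cases hw : w ∈ U
    · obtain ⟨u, hu, hwu, huy⟩ := ih.2 hw
      have hzu : G.DirVia U z u := (DirVia.of_E e).trans hw hwu
      exact ⟨fun hz => .head ⟨⟨hn.1, hz⟩, hu, hzu⟩ huy, fun _ => ⟨u, hu, hzu, huy⟩⟩
    · exact ⟨fun hz => .head ⟨⟨hn.1, hz⟩, ⟨hn.2, hw⟩, .of_E e⟩ (ih.1 hw),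
        fun _ => ⟨w, ⟨hn.2, hw⟩, .of_E e, ih.1 hw⟩⟩

theorem reflTransGen_of_marg {U : Set V} {x y : V}
    (h : Relation.ReflTransGen (G.marg U).E x y) : Relation.ReflTransGen G.E x y := by
  induction h with
  | refl => exact .refl
  | tail _ h ih => exact ih.trans h.2.2.reflTransGen

/-! ### Ancestral parts as marginalizations -/

theorem ext_of {G G' : HEDG V} (hn : G.nodes = G'.nodes) (hE : ∀ v w, G.E v w ↔ G'.E v w)
    (hH : ∀ F, F ∈ G.H ↔ F ∈ G'.H) : G = G' := by
  obtain ⟨n, E, H, _, _, _, _⟩ := G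
  obtain ⟨n', E', H', _, _, _, _⟩ := G'
  obtain rfl : n = n' := hn
  obtain rfl : E = E' := by
    funext v w
    exact propext (hE v w)
  obtain rfl : H = H' := Set.ext hH
  rfl

/-- The marginalization of `G` onto the nodes in `A`. -/
abbrev onto (G : HEDG V) (A : Set V) : HEDG V := G.marg Aᶜ

/-- A directed path ending in `A` visits only ancestors of `A`; those outside `A` lie in `U`. So
marginalizing out the further nodes of `Aᶜ` creates nothing new. -/
theorem sub_marg_eq_onto {U A : Set V} (hA : A ⊆ G.nodes \ U) (hanc : G.Anc A ⊆ A ∪ U) :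
    (G.marg U).sub A = G.onto A := by
  have hUA : U ⊆ Aᶜ := fun u hu hu' => (hA hu').2 hu
  have hAU : Aᶜ ∩ G.Anc A ⊆ U := fun u hu => (hanc hu.2).resolve_left hu.1
  have hD : ∀ {x y}, y ∈ A → (G.DirVia U x y ↔ G.DirVia Aᶜ x y) := fun hy =>
    ⟨DirVia.restrict hy fun _ h => hUA h.1, DirVia.restrict hy hAU⟩
  refine ext_of ?_ (fun v w => ?_) fun F => ?_
  · ext v
    exact ⟨fun h => ⟨h.1.1, fun h' => h' h.2⟩, fun h => ⟨hA (not_not.1 h.2), not_not.1 h.2⟩⟩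
  · constructor
    · rintro ⟨⟨h1, h2, h3⟩, hF, hv⟩
      exact ⟨⟨h1.1, fun h => h hF⟩, ⟨h2.1, fun h => h hv⟩, (hD hv).1 h3⟩
    · rintro ⟨⟨h1, h1'⟩, ⟨h2, h2'⟩, h3⟩
      exact ⟨⟨hA (not_not.1 h1'), hA (not_not.1 h2'), (hD (not_not.1 h2')).2 h3⟩,
        not_not.1 h1', not_not.1 h2'⟩
  · constructor
    · rintro ⟨⟨h1, T, hT, hTF, h2⟩, hFA⟩
      refine ⟨fun x hx => ⟨(h1 hx).1, fun h => h (hFA hx)⟩, T, hT,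
        hTF.trans (union_subset_union_right _ hUA), fun x hx => ?_⟩
      rcases h2 x hx with h | ⟨u, hu, hux⟩
      · exact Or.inl ⟨h.1, fun h => h (hFA hx)⟩
      · exact Or.inr ⟨u, ⟨hu.1, hUA hu.2⟩, (hD (hFA hx)).1 hux⟩
    · rintro ⟨h1, T, hT, hTF, h2⟩
      have hFA : F ⊆ A := fun x hx => not_not.1 (h1 hx).2
      -- The hyperedge may contain nodes of `Aᶜ` outside `U`; none of them leads into `F`, so they
      -- can be dropped.
      refine ⟨⟨hFA.trans hA, T ∩ (F ∪ U), G.H_down hT inter_subset_left, inter_subset_right,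
        fun x hx => ?_⟩, hFA⟩
      rcases h2 x hx with h | ⟨u, hu, hux⟩
      · exact Or.inl ⟨⟨h.1, Or.inl hx⟩, (hA (hFA hx)).2⟩
      · have huU : u ∈ U := hAU ⟨hu.2, G.H_nodes hT hu.1, x, hFA hx, hux.reflTransGen⟩
        exact Or.inr ⟨u, ⟨⟨hu.1, Or.inr huU⟩, huU⟩, (hD (hFA hx)).2 hux⟩

theorem marg_sub_eq_onto {A S : Set V} (hA : A ⊆ G.nodes) (hanc : G.Anc A ⊆ A) :
    (G.sub A).marg S = G.onto (A \ S) := by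
  rw [← sub_marg_eq_onto (U := S) (fun x hx => ⟨hA hx.1, hx.2⟩)
    (fun x hx => by
      by_cases hxS : x ∈ S
      · exact Or.inr hxS
      · exact Or.inl ⟨hanc (anc_mono sdiff_subset hx), hxS⟩)]
  have hD : ∀ {x y}, y ∈ A → (G.DirVia S x y → (G.sub A).DirVia S x y) := by
    rintro x y hy ⟨t, ht, e⟩
    have htA : t ∈ A := hanc ⟨(G.E_nodes e).1, y, hy, .single e⟩
    have key : ∀ {t}, t ∈ A → Relation.ReflTransGen (fun a b => G.E a b ∧ b ∈ S) x t →
        Relation.ReflTransGen (fun a b => (G.sub A).E a b ∧ b ∈ S) x t ∧ x ∈ A := by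
      intro t htA ht
      induction ht with
      | refl => exact ⟨.refl, htA⟩
      | @tail b c _ h ih =>
        have hb : b ∈ A := hanc ⟨(G.E_nodes h.1).1, c, htA, .single h.1⟩
        exact ⟨(ih hb).1.tail ⟨⟨h.1, hb, htA⟩, h.2⟩, (ih hb).2⟩
    exact ⟨t, (key htA ht).1, e, htA, hy⟩
  have hD' : ∀ {x y}, (G.sub A).DirVia S x y → G.DirVia S x y := by
    rintro x y ⟨t, ht, e⟩
    exact ⟨t, Relation.ReflTransGen.mono (fun _ _ h => ⟨h.1.1, h.2⟩) _ _ ht, e.1⟩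
  refine ext_of ?_ (fun v w => ?_) fun F => ?_
  · ext v
    exact ⟨fun h => ⟨⟨h.1.1, h.2⟩, h.1.2, h.2⟩, fun h => ⟨⟨h.1.1, h.2.1⟩, h.1.2⟩⟩
  · constructor
    · rintro ⟨h1, h2, h3⟩
      exact ⟨⟨⟨h1.1.1, h1.2⟩, ⟨h2.1.1, h2.2⟩, hD' h3⟩, ⟨h1.1.2, h1.2⟩, ⟨h2.1.2, h2.2⟩⟩
    · rintro ⟨⟨h1, h2, h3⟩, h4, h5⟩
      exact ⟨⟨⟨h1.1, h4.1⟩, h1.2⟩, ⟨⟨h2.1, h5.1⟩, h2.2⟩, hD h5.1 h3⟩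
  · constructor
    · rintro ⟨h1, T, hT, hTF, h2⟩
      refine ⟨⟨fun x hx => ⟨(h1 hx).1.1, (h1 hx).2⟩, T, hT.1, hTF, fun x hx => ?_⟩,
        fun x hx => ⟨(h1 hx).1.2, (h1 hx).2⟩⟩
      rcases h2 x hx with h | ⟨u, hu, hux⟩
      · exact Or.inl h
      · exact Or.inr ⟨u, hu, hD' hux⟩
    · rintro ⟨⟨h1, T, hT, hTF, h2⟩, hFA⟩
      refine ⟨fun x hx => ⟨⟨(h1 hx).1, (hFA hx).1⟩, (h1 hx).2⟩, T ∩ A,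
        ⟨G.H_down hT inter_subset_left, inter_subset_right⟩, inter_subset_left.trans hTF,
        fun x hx => ?_⟩
      rcases h2 x hx with h | ⟨u, hu, hux⟩
      · exact Or.inl ⟨⟨h.1, (hFA hx).1⟩, h.2⟩
      · exact Or.inr ⟨u, ⟨⟨hu.1, hanc ⟨G.H_nodes hT hu.1, x, (hFA hx).1, hux.reflTransGen⟩⟩,
          hu.2⟩, hD (hFA hx).1 hux⟩

/-! ### Walks -/

/-- There is a walk from `x` to `w`, the last edge of which has the kind `k`, such that all inner
colliders lie in `C` and all inner non-colliders lie in `N`. -/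
inductive OpenWalk (G : HEDG V) (N C : Set V) (x : V) : V → EdgeKind → Prop
  | single {u : V} {k : EdgeKind} (h : G.Edge k x u) : OpenWalk G N C x u k
  | snoc {u w : V} {k k' : EdgeKind} (p : OpenWalk G N C x u k) (h : G.Edge k' u w)
      (hC : k.HeadRight ∧ k'.HeadLeft → u ∈ C) (hN : ¬ (k.HeadRight ∧ k'.HeadLeft) → u ∈ N) :
      OpenWalk G N C x w k'

/-- Walks grow at their right end and paths at their left end, so the walk is unwound onto the front
of `p`. The start of its last edge is not recorded in `OpenWalk`; hence `hp` ranges over all edges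
into `u` with the same arrowhead there, the only feature that matters for blocking at `u`. -/
theorem OpenWalk.exists_path {Z : Set V} {x : V} {u : V} {k : EdgeKind}
    (h : G.OpenWalk Zᶜ (G.Anc Z) x u k) {y : V} (p : G.Path u y)
    (hp : ∀ (z : V) (k' : EdgeKind) (e : G.Edge k' z u), (k'.HeadRight ↔ k.HeadRight) →
      ¬ (Path.cons k' e p).InnerBlocked Z) : ∃ q : G.Path x y, ¬ q.InnerBlocked Z := by
  induction h generalizing y with
  | @single u k e => exact ⟨.cons k e p, hp x k e Iff.rfl⟩
  | @snoc u w k k' h e hC hN ih =>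
    refine ih (.cons k' e p) fun z k'' e'' hk => ?_
    rintro (⟨h1, h2⟩ | ⟨h1, h2⟩ | h1)
    · exact h2 (hC ⟨hk.1 h1.1, h1.2⟩)
    · exact hN (fun h => h1 ⟨hk.2 h.1, h.2⟩) h2
    · exact hp u k' e Iff.rfl h1

theorem OpenWalk.exists_path_of_mem_nodes {Z : Set V} {x y : V} {k : EdgeKind}
    (h : G.OpenWalk Zᶜ (G.Anc Z) x y k) (hy : y ∈ G.nodes) :
    ∃ q : G.Path x y, ¬ q.InnerBlocked Z :=
  h.exists_path (.nil y hy) fun _ _ _ _ => id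

theorem OpenWalk.of_path {Z : Set V} {x u y : V} (p : G.Path u y) {k : EdgeKind}
    (h : G.OpenWalk Zᶜ (G.Anc Z) x u k) (z : V) (e : G.Edge k z u)
    (hp : ¬ (Path.cons k e p).InnerBlocked Z) : ∃ k', G.OpenWalk Zᶜ (G.Anc Z) x y k' := by
  induction p generalizing z k with
  | nil => exact ⟨k, h⟩
  | @cons a b c k' e' p ih =>
    refine ih (.snoc h e' (fun hk => ?_) fun hk => ?_) a e' fun hb => hp (Or.inr (Or.inr hb))
    · by_contra hc
      exact hp (Or.inl ⟨hk, hc⟩)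
    · exact fun hz => hp (Or.inr (Or.inl ⟨hk, hz⟩))

theorem exists_openWalk_of_path {Z : Set V} {x y : V} (p : G.Path x y)
    (hp : ¬ p.InnerBlocked Z) : x = y ∨ ∃ k, G.OpenWalk Zᶜ (G.Anc Z) x y k := by
  cases p with
  | nil => exact Or.inl rfl
  | cons k e p => exact Or.inr (OpenWalk.of_path p (.single e) x e hp)

/-- If no endpoint lies in the conditioning set, then d-separation excludes open walks. -/
theorem DSep.not_openWalk {X Y Z : Set V} (h : G.DSep X Y Z) {x y : V} (hx : x ∈ X) (hy : y ∈ Y)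
    (hyN : y ∈ G.nodes) (hxZ : x ∉ Z) (hyZ : y ∉ Z) {k : EdgeKind} :
    ¬ G.OpenWalk Zᶜ (G.Anc Z) x y k := by
  intro hw
  obtain ⟨q, hq⟩ := hw.exists_path_of_mem_nodes hyN
  rcases h x hx y hy q with h | h | h
  · exact hxZ h
  · exact hyZ h
  · exact hq h

/-! ### Moralizations of marginalizations -/

/-- `x` is `a`, or `x` lies outside of `A` and is connected to `a` by a directed path with all its
inner nodes outside of `A`. -/
def Falls (G : HEDG V) (A : Set V) (x a : V) : Prop := x = a ∨ (x ∉ A ∧ G.DirVia Aᶜ x a)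

/-- There is a bidirected trek between `a` and `b` with all its inner nodes outside of `A`. -/
def Trek (G : HEDG V) (A : Set V) (a b : V) : Prop :=
  ∃ f g, G.Falls A f a ∧ G.Falls A g b ∧ {f, g} ∈ G.H

theorem Falls.trans {A : Set V} {x u a : V} (h : G.Falls A x u) (h' : G.Falls A u a) :
    G.Falls A x a := by
  rcases h with rfl | ⟨hx, h⟩
  · exact h'
  rcases h' with rfl | ⟨hu, h'⟩
  · exact Or.inr ⟨hx, h⟩
  · exact Or.inr ⟨hx, h.trans hu h'⟩

theorem falls_of_dirVia {A : Set V} {x u a : V} (h : G.DirVia Aᶜ x u) (h' : G.Falls A u a) :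
    G.DirVia Aᶜ x a := by
  rcases h' with rfl | ⟨hu, h'⟩
  · exact h
  · exact h.trans hu h'

theorem Trek.falls {A : Set V} {b u a : V} (h : G.Trek A b u) (h' : G.Falls A u a) :
    G.Trek A b a := by
  obtain ⟨f, g, hf, hg, H⟩ := h
  exact ⟨f, g, hf, hg.trans h', H⟩

theorem exists_falls_of_mem_anc {A : Set V} {u : V} (hu : u ∈ G.Anc A) :
    ∃ a ∈ A, G.Falls A u a := by
  obtain ⟨-, a, ha, hua⟩ := hu
  induction hua using Relation.ReflTransGen.head_induction_on with
  | refl => exact ⟨a, ha, Or.inl rfl⟩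
  | @head u w e _ ih =>
    by_cases huA : u ∈ A
    · exact ⟨u, huA, Or.inl rfl⟩
    obtain ⟨b, hb, hwb⟩ := ih
    exact ⟨b, hb, Or.inr ⟨huA, falls_of_dirVia (.of_E e) hwb⟩⟩

theorem onto_nodes {A : Set V} (hA : A ⊆ G.nodes) : (G.onto A).nodes = A := by
  ext x
  exact ⟨fun h => not_not.1 h.2, fun h => ⟨hA h, fun h' => h' h⟩⟩

theorem onto_E_iff {A : Set V} (hA : A ⊆ G.nodes) {x y : V} :
    (G.onto A).E x y ↔ x ∈ A ∧ y ∈ A ∧ G.DirVia Aᶜ x y := by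
  have h : ∀ z, z ∈ G.nodes \ Aᶜ ↔ z ∈ A := fun z => Set.ext_iff.1 (onto_nodes hA) z
  exact and_congr (h x) (and_congr_left fun _ => h y)

/-- Two nodes of a hyperedge suffice as sources for `x` and `y`, and a simplicial complex contains
the pair of them. The two sources may coincide, so forks are included. -/
theorem onto_bidir_iff {A : Set V} (hA : A ⊆ G.nodes) {x y : V} :
    (G.onto A).Bidir x y ↔ x ≠ y ∧ x ∈ A ∧ y ∈ A ∧ G.Trek A x y := by
  constructor
  · rintro ⟨hne, h1, F, hF, hFA, h2⟩
    have hmem : ∀ z ∈ ({x, y} : Set V), z ∈ A := fun z hz => not_not.1 (h1 hz).2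
    have key : ∀ z ∈ ({x, y} : Set V), ∃ f ∈ F, G.Falls A f z := by
      intro z hz
      rcases h2 z hz with h | ⟨u, hu, huz⟩
      · exact ⟨z, h.1, Or.inl rfl⟩
      · exact ⟨u, hu.1, Or.inr ⟨hu.2, huz⟩⟩
    obtain ⟨f, hf, hfx⟩ := key x (by simp)
    obtain ⟨g, hg, hgy⟩ := key y (by simp)
    exact ⟨hne, hmem x (by simp), hmem y (by simp), f, g, hfx, hgy,
      G.H_down hF (Set.pair_subset hf hg)⟩
  · rintro ⟨hne, hx, hy, f, g, hf, hg, H⟩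
    refine ⟨hne, ?_, {f, g}, H, ?_, ?_⟩
    · exact Set.pair_subset ⟨hA hx, fun h => h hx⟩ ⟨hA hy, fun h => h hy⟩
    · refine Set.pair_subset ?_ ?_
      · rcases hf with rfl | h
        · exact Or.inl (Or.inl rfl)
        · exact Or.inr h.1
      · rcases hg with rfl | h
        · exact Or.inl (Or.inr rfl)
        · exact Or.inr h.1
    · rintro z (rfl | rfl)
      · rcases hf with rfl | h
        · exact Or.inl ⟨Or.inl rfl, fun h => h hx⟩
        · exact Or.inr ⟨f, ⟨Or.inl rfl, h.1⟩, h.2⟩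
      · rcases hg with rfl | h
        · exact Or.inl ⟨Or.inr rfl, fun h => h hy⟩
        · exact Or.inr ⟨g, ⟨Or.inr rfl, h.1⟩, h.2⟩

/-- `b` is in the union of the districts of `v` and its children in the marginalization onto
`A`. -/
def Chain (G : HEDG V) (A : Set V) (v b : V) : Prop :=
  b ∈ A ∧ ∃ a, (v = a ∨ (G.onto A).E v a) ∧ Relation.ReflTransGen (G.onto A).Bidir a b

theorem Chain.trek {A : Set V} (hA : A ⊆ G.nodes) {v b a : V} (h : G.Chain A v b) (ha : a ∈ A)
    (h' : G.Trek A b a) : G.Chain A v a := by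
  obtain ⟨hb, c, hc, hcb⟩ := h
  by_cases hba : b = a
  · exact hba ▸ ⟨hb, c, hc, hcb⟩
  · exact ⟨ha, c, hc, hcb.tail ((onto_bidir_iff hA).2 ⟨hba, hb, ha, h'⟩)⟩

theorem Chain.of_dirVia {A : Set V} (hA : A ⊆ G.nodes) {v a : V} (hv : v ∈ A) (ha : a ∈ A)
    (h : G.DirVia Aᶜ v a) : G.Chain A v a :=
  ⟨ha, a, Or.inr ((onto_E_iff hA).2 ⟨hv, ha, h⟩), .refl⟩

/-- The condition on `u` that corresponds to a walk from `v` to `u` with a last edge of kind `k`,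
and with all inner nodes being non-colliders outside of `A` or colliders that are ancestors of
`A`. -/
def Reach (G : HEDG V) (A : Set V) (v u : V) (k : EdgeKind) : Prop :=
  (k.HeadRight → G.DirVia Aᶜ v u ∨ ∃ b, G.Chain A v b ∧ G.Trek A b u) ∧
  (¬ k.HeadRight → ∃ b, G.Chain A v b ∧ G.DirVia Aᶜ u b)

/-- An edge out of a node that is the start of a trek, with an arrowhead at this node. -/
theorem Reach.of_edge_headLeft {A : Set V} {v u b w : V} {k : EdgeKind} (hb : G.Chain A v b)
    (hu : G.Falls A u b) (e : G.Edge k u w) (hk : k.HeadLeft) : G.Reach A v w k := by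
  cases k with
  | right => exact hk.elim
  | left => exact ⟨fun h => h.elim, fun _ => ⟨b, hb, falls_of_dirVia (.of_E e) hu⟩⟩
  | bi => exact ⟨fun _ => Or.inr ⟨b, hb, u, w, hu, Or.inl rfl, e.2⟩, fun h => absurd trivial h⟩

theorem Reach.single {A : Set V} {v w : V} {k : EdgeKind} (hv : v ∈ A) (e : G.Edge k v w) :
    G.Reach A v w k := by
  by_cases hk : k.HeadLeft
  · exact of_edge_headLeft ⟨hv, v, Or.inl rfl, .refl⟩ (Or.inl rfl) e hk
  · cases k with
    | right => exact ⟨fun _ => Or.inl (.of_E e), fun h => absurd trivial h⟩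
    | left => exact absurd trivial hk
    | bi => exact absurd trivial hk

theorem Reach.chain {A : Set V} (hA : A ⊆ G.nodes) {v u a : V} {k : EdgeKind} (hv : v ∈ A)
    (h : G.Reach A v u k) (hk : k.HeadRight) (ha : a ∈ A) (hua : G.Falls A u a) :
    G.Chain A v a := by
  rcases h.1 hk with h | ⟨b, hb, hbu⟩
  · exact .of_dirVia hA hv ha (falls_of_dirVia h hua)
  · exact hb.trek hA ha (hbu.falls hua)

/-- From the collider a directed path falls to a first node `a` of `A`. This `a` joins the chain,
and the walk leaves again from `a` by going back up to `u`. -/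
theorem Reach.collider {A : Set V} (hA : A ⊆ G.nodes) {v u w : V} {k k' : EdgeKind} (hv : v ∈ A)
    (h : G.Reach A v u k) (hk : k.HeadRight) (hu : u ∈ G.Anc A) (e : G.Edge k' u w)
    (hk' : k'.HeadLeft) : G.Reach A v w k' := by
  obtain ⟨a, ha, hua⟩ := exists_falls_of_mem_anc hu
  exact .of_edge_headLeft (h.chain hA hv hk ha hua) hua e hk'

theorem Reach.nonCollider {A : Set V} {v u w : V} {k k' : EdgeKind}
    (h : G.Reach A v u k) (hu : u ∉ A) (e : G.Edge k' u w)
    (hk : ¬ (k.HeadRight ∧ k'.HeadLeft)) : G.Reach A v w k' := by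
  by_cases hr : k.HeadRight
  · cases k' with
    | left => exact absurd ⟨hr, trivial⟩ hk
    | bi => exact absurd ⟨hr, trivial⟩ hk
    | right =>
      refine ⟨fun _ => ?_, fun h => absurd trivial h⟩
      rcases h.1 hr with h | ⟨b, hb, hbu⟩
      · exact Or.inl (h.trans_E hu e)
      · exact Or.inr ⟨b, hb, hbu.falls (Or.inr ⟨hu, .of_E e⟩)⟩
  · obtain ⟨b, hb, hub⟩ := h.2 hr
    by_cases hl : k'.HeadLeft
    · exact .of_edge_headLeft hb (Or.inr ⟨hu, hub⟩) e hl
    · cases k' with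
      | left => exact absurd trivial hl
      | bi => exact absurd trivial hl
      | right =>
        have huN : u ∈ G.nodes := (G.E_nodes e).1
        -- A fork at `u` is a trek with both sources equal to `u`, since `{u}` is a hyperedge.
        exact ⟨fun _ => Or.inr ⟨b, hb, u, u, Or.inr ⟨hu, hub⟩, Or.inr ⟨hu, .of_E e⟩,
          by simpa using G.H_singleton huN⟩, fun h => absurd trivial h⟩

theorem Reach.adj {A : Set V} (hA : A ⊆ G.nodes) {v u : V} {k : EdgeKind} (hv : v ∈ A)
    (hu : u ∈ A) (hne : v ≠ u) (h : G.Reach A v u k) : (G.onto A).moral.Adj v u := by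
  have hN := onto_nodes hA
  by_cases hk : k.HeadRight
  · obtain ⟨-, a, ha, hau⟩ := h.chain hA hv hk hu (Or.inl rfl)
    exact ⟨hne, hN.symm ▸ hv, hN.symm ▸ hu, a, u, ha, Or.inl rfl, hau⟩
  · obtain ⟨b, ⟨hb, a, ha, hab⟩, hub⟩ := h.2 hk
    exact ⟨hne, hN.symm ▸ hv, hN.symm ▸ hu, a, b, ha, Or.inr ((onto_E_iff hA).2 ⟨hu, hb, hub⟩),
      hab⟩

/-! ### Walks along adjacencies in the moralization -/

theorem OpenWalk.dirVia {N C U : Set V} (hU : U ⊆ N) {x u w : V} {k : EdgeKind}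
    (h : G.OpenWalk N C x u k) (hu : u ∈ N) (e : G.DirVia U u w) : G.OpenWalk N C x w .right := by
  obtain ⟨t, ht, e⟩ := e
  have key : ∃ k', G.OpenWalk N C x t k' ∧ t ∈ N := by
    clear e
    induction ht with
    | refl => exact ⟨k, h, hu⟩
    | tail _ h ih =>
      obtain ⟨k', hk', ht⟩ := ih
      exact ⟨.right, .snoc hk' h.1 (fun h => h.2.elim) fun _ => ht, hU h.2⟩
  obtain ⟨k', hk', ht⟩ := key
  exact .snoc hk' e (fun h => h.2.elim) fun _ => ht

theorem OpenWalk.single_dirVia {N C U : Set V} (hU : U ⊆ N) {x w : V} (e : G.DirVia U x w) :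
    G.OpenWalk N C x w .right := by
  rcases e.head_cases with e | ⟨u, hu, e, h⟩
  · exact .single e
  · exact OpenWalk.dirVia hU (.single (k := .right) e) (hU hu) h

/-- Extending walks against the direction of a directed path. -/
theorem exists_of_dirVia_reverse {U : Set V} {Q : V → EdgeKind → Prop} {w x : V}
    (e : G.DirVia U x w) (h1 : ∀ {y}, G.E y w → Q y .left)
    (h2 : ∀ {u y}, u ∈ U → Q u .left → G.E y u → Q y .left) : Q x .left := by
  obtain ⟨t, ht, e⟩ := e
  have key : Q t .left := h1 e
  clear e
  induction ht with
  | refl => exact key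
  | tail _ h ih => exact ih (h2 h.2 key h.1)

/-- A condition under which a walk can be continued by an edge with an arrowhead at its start. -/
def OpenWalk.Left (G : HEDG V) (N C : Set V) (x u : V) : Prop :=
  x = u ∨ ∃ k, G.OpenWalk N C x u k ∧ (k.HeadRight → u ∈ C) ∧ (¬ k.HeadRight → u ∈ N)

theorem OpenWalk.Left.edge {N C : Set V} {x u w : V} (h : OpenWalk.Left G N C x u) {k : EdgeKind}
    (e : G.Edge k u w) (hk : k.HeadLeft) : G.OpenWalk N C x w k := by
  rcases h with rfl | ⟨k', h, hC, hN⟩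
  · exact .single e
  · exact .snoc h e (fun h => hC h.1) fun h => hN fun h' => h ⟨h', hk⟩

theorem OpenWalk.Left.dirVia {N C U : Set V} (hU : U ⊆ N) {x u w : V}
    (h : OpenWalk.Left G N C x u) (e : G.DirVia U w u) : G.OpenWalk N C x w .left :=
  exists_of_dirVia_reverse (Q := fun y k => G.OpenWalk N C x y k) e
    (fun e => h.edge (k := .left) e trivial)
    fun hu h e => .snoc (k' := .left) h e (fun h => h.1.elim) fun _ => hU hu

theorem OpenWalk.Left.falls {N C A : Set V} (hU : Aᶜ ⊆ N) {x u w : V}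
    (h : OpenWalk.Left G N C x u) (e : G.Falls A w u) : OpenWalk.Left G N C x w := by
  rcases e with rfl | ⟨hw, e⟩
  · exact h
  · exact Or.inr ⟨.left, h.dirVia hU e, fun h => h.elim, fun _ => hU hw⟩

theorem OpenWalk.falls {N C A : Set V} (hU : Aᶜ ⊆ N) {x u w : V} {k : EdgeKind}
    (hk : k.HeadRight) (h : G.OpenWalk N C x u k) (e : G.Falls A u w) :
    ∃ k, k.HeadRight ∧ G.OpenWalk N C x w k := by
  rcases e with rfl | ⟨hu, e⟩
  · exact ⟨k, hk, h⟩
  · exact ⟨.right, trivial, OpenWalk.dirVia hU h (hU hu) e⟩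

theorem OpenWalk.Left.trek {N C A : Set V} (hU : Aᶜ ⊆ N) {x u w : V}
    (h : OpenWalk.Left G N C x u) (hne : u ≠ w) (hu : u ∈ A) (hw : w ∈ A) (e : G.Trek A u w) :
    ∃ k, k.HeadRight ∧ G.OpenWalk N C x w k := by
  obtain ⟨f, g, hf, hg, H⟩ := e
  have h' := h.falls hU hf
  by_cases hfg : f = g
  -- `Bidir` requires distinct ends, so here the trek is a fork at a node outside `A`, which serves
  -- as a non-collider.
  · subst hfg
    have hfA : f ∉ A := by
      rcases hf with rfl | hf
      · rcases hg with rfl | hg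
        · exact absurd rfl hne
        · exact hg.1
      · exact hf.1
    rcases hg with rfl | ⟨-, hg⟩
    · exact absurd hw hfA
    rcases h' with rfl | ⟨k, h', -⟩
    · exact ⟨.right, trivial, OpenWalk.single_dirVia hU hg⟩
    · exact ⟨.right, trivial, OpenWalk.dirVia hU h' (hU hfA) hg⟩
  · exact OpenWalk.falls hU (k := .bi) trivial (h'.edge (k := .bi) ⟨hfg, H⟩ trivial) hg

/-- Every edge of the marginalization unfolds to a walk with its inner nodes outside `A` as
non-colliders. The bidirected edges meet in nodes of `A`, which become colliders. -/
theorem exists_openWalk_of_adj {A : Set V} (hA : A ⊆ G.nodes) {x y : V}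
    (h : (G.onto A).moral.Adj x y) : ∃ k, G.OpenWalk Aᶜ (G.Anc A) x y k := by
  obtain ⟨hne, -, -, a, b, ha, hb, hab⟩ := h
  have hanc : A ⊆ G.Anc A := fun z hz => ⟨hA hz, z, hz, .refl⟩
  have hsub : Aᶜ ⊆ Aᶜ := Subset.rfl
  have key : x = b ∨ ∃ k, k.HeadRight ∧ G.OpenWalk Aᶜ (G.Anc A) x b k := by
    clear hb
    induction hab with
    | refl =>
      rcases ha with ha | ha
      · exact Or.inl ha
      · exact Or.inr ⟨.right, trivial, OpenWalk.single_dirVia hsub ((onto_E_iff hA).1 ha).2.2⟩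
    | @tail b c _ h ih =>
      obtain ⟨hbc, hbA, hcA, ht⟩ := (onto_bidir_iff hA).1 h
      -- If the chain returns to `x`, the walk built so far is discarded and restarted there.
      by_cases hxc : x = c
      · exact Or.inl hxc
      have hl : OpenWalk.Left G Aᶜ (G.Anc A) x b := by
        rcases ih with h | ⟨k, hk, h⟩
        · exact Or.inl h
        · exact Or.inr ⟨k, h, fun _ => hanc hbA, fun h => absurd hk h⟩
      exact Or.inr (hl.trek hsub hbc hbA hcA ht)
  have hl : b ∈ A → OpenWalk.Left G Aᶜ (G.Anc A) x b := by
    intro hbA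
    rcases key with h | ⟨k, hk, h⟩
    · exact Or.inl h
    · exact Or.inr ⟨k, h, fun _ => hanc hbA, fun h => absurd hk h⟩
  rcases hb with rfl | hb
  · rcases key with h | ⟨k, -, h⟩
    · exact absurd h hne
    · exact ⟨k, h⟩
  · obtain ⟨-, hbA, hd⟩ := (onto_E_iff hA).1 hb
    exact ⟨.left, (hl hbA).dirVia hsub hd⟩

/-! ### Markov blankets and d-separation -/

/-- The Markov blanket of `v` in a marginalization d-separates `v` from the other nodes. -/
theorem dSep_blanket {A : Set V} (hA : A ⊆ G.nodes) {v : V} (hv : v ∈ A) :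
    G.DSep {v} (A \ {v}) ((G.onto A).blanket v) := by
  intro v' hv' y ⟨hyA, hyv⟩ p
  obtain rfl : v' = v := hv'
  by_contra hblocked
  obtain ⟨-, hyB, hp⟩ : _ ∧ y ∉ (G.onto A).blanket v' ∧ _ := by
    simpa only [Path.Blocked, not_or] using hblocked
  have hBA : (G.onto A).blanket v' ⊆ A := fun w hw => by
    have := hw.2.2.1
    rwa [onto_nodes hA] at this
  rcases exists_openWalk_of_path p hp with rfl | ⟨k, hk⟩
  · exact hyv rfl
  · have key : G.Reach A v' y k := by
      clear hyB hyv hyA hp hblocked p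
      induction hk with
      | single e => exact .single hv e
      | @snoc u w k k' _ e hC hN ih =>
        by_cases hc : k.HeadRight ∧ k'.HeadLeft
        · exact ih.collider hA hv hc.1 (anc_mono hBA (hC hc)) e hc.2
        · by_cases huA : u ∈ A
          -- A non-collider in `A` lies outside the blanket, so it can only be `v'` itself, where
          -- the walk restarts.
          · by_cases huv : v' = u
            · exact .single hv (by rwa [huv])
            · exact absurd (ih.adj hA hv huA huv) (hN hc)
          · exact ih.nonCollider huA e hc
    exact hyB (key.adj hA hv hyA fun h => hyv h.symm)

/-- Removing a node from the nodes of a marginalization connects at most the neighbours of this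
node. -/
theorem adj_or_adj_of_adj_sdiff {A : Set V} (hA : A ⊆ G.nodes) {v x y : V} (hv : v ∈ A)
    (h : (G.onto (A \ {v})).moral.Adj x y) :
    (G.onto A).moral.Adj x y ∨ ((G.onto A).moral.Adj v x ∧ (G.onto A).moral.Adj v y) := by
  have hA' : A \ {v} ⊆ G.nodes := sdiff_subset.trans hA
  have hx : x ∈ A \ {v} := by
    have := h.2.1
    rwa [onto_nodes hA'] at this
  have hy : y ∈ A \ {v} := by
    have := h.2.2.1
    rwa [onto_nodes hA'] at this
  have hne := h.1
  obtain ⟨k, hk⟩ := exists_openWalk_of_adj hA' h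
  -- The only non-collider on the walk that can lie in `A` is `v`. Its first such visit gives
  -- adjacency to `x`; after each visit the walk restarts at `v`.
  have key : G.Reach A x y k ∨ ((G.onto A).moral.Adj v x ∧ G.Reach A v y k) := by
    clear h hne hy
    induction hk with
    | single e => exact Or.inl (.single hx.1 e)
    | @snoc u w k k' _ e hC hN ih =>
      by_cases hc : k.HeadRight ∧ k'.HeadLeft
      · have hu := anc_mono sdiff_subset (hC hc)
        exact ih.imp (fun h => h.collider hA hx.1 hc.1 hu e hc.2)
          fun h => ⟨h.1, h.2.collider hA hv hc.1 hu e hc.2⟩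
      · by_cases huv : u = v
        · subst huv
          refine Or.inr ⟨?_, .single hv e⟩
          rcases ih with h | h
          · exact (h.adj hA hx.1 hv fun h => hx.2 h).symm
          · exact h.1
        · have huA : u ∉ A := fun h => hN hc ⟨h, huv⟩
          exact ih.imp (fun h => h.nonCollider huA e hc) fun h => ⟨h.1, h.2.nonCollider huA e hc⟩
  rcases key with h | ⟨h1, h⟩
  · exact Or.inl (h.adj hA hx.1 hy.1 hne)
  · exact Or.inr ⟨h1, h.adj hA hv hy.1 fun h => hy.2 h.symm⟩

/-- d-separation yields a separation of the moralization of the ancestors. -/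
theorem DSep.exists_partition {X Y Z A : Set V} (h : G.DSep X Y Z) (hX : X ⊆ G.nodes)
    (hY : Y ⊆ G.nodes) (hZ : Z ⊆ G.nodes) (hA : A = G.Anc (X ∪ Y ∪ Z)) :
    ∃ X' Y' : Set V, X ⊆ X' ∪ Z ∧ Y ⊆ Y' ∪ Z ∧ X' ∪ Y' = A \ Z ∧ Disjoint X' Y' ∧
      ∀ x ∈ X', ∀ y ∈ Y', ¬ (G.onto A).moral.Adj x y := by
  have hAN : A ⊆ G.nodes := hA ▸ fun x hx => hx.1
  have hAA : G.Anc A ⊆ A := by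
    rintro a ⟨-, b, hb, hab⟩
    rw [hA] at hb ⊢
    exact mem_anc_of_reflTransGen hab hb
  have hXA : X ⊆ A := fun x hx => hA ▸ ⟨hX hx, x, Or.inl (Or.inl hx), .refl⟩
  have hYA : Y ⊆ A := fun x hx => hA ▸ ⟨hY hx, x, Or.inl (Or.inr hx), .refl⟩
  let S : V → EdgeKind → Prop := fun u k => ∃ x ∈ X \ Z, G.OpenWalk Zᶜ (G.Anc Z) x u k
  have hSY : ∀ {u k}, S u k → u ∈ Y → u ∈ Z := by
    rintro u k ⟨x, hx, hw⟩ hu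
    by_contra huZ
    exact h.not_openWalk hx.1 hu (hY hu) hx.2 huZ hw
  have hstep : ∀ {u w k k'}, S u k → G.Edge k' u w → (k.HeadRight ∧ k'.HeadLeft → u ∈ G.Anc Z) →
      (¬ (k.HeadRight ∧ k'.HeadLeft) → u ∉ Z) → S w k' :=
    fun ⟨x, hx, hw⟩ e hC hN => ⟨x, hx, .snoc hw e hC hN⟩
  -- If `u` is not an ancestor of `Z`, it has a directed path avoiding `Z` to `X` or to `Y`. A path
  -- to `Y` would prolong the walk to a forbidden one; a path to `X`, read backwards, is a walk that
  -- reaches `u` with no arrowhead.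
  have hfree : ∀ {u k}, S u k → u ∈ A →
      u ∈ G.Anc Z ∨ u ∈ X \ Z ∨ ∃ k', S u k' ∧ ¬ k'.HeadRight := by
    intro u k hS hu
    by_cases huZ : u ∈ G.Anc Z
    · exact Or.inl huZ
    right
    rw [hA] at hu
    obtain ⟨huN, t, ht, hut⟩ := hu
    have hnZ : ∀ {w}, w ∈ G.nodes → w ∉ G.Anc Z → w ∉ Z := fun hw h hwZ => h ⟨hw, _, hwZ, .refl⟩
    rcases ht with (ht | ht) | ht
    · clear hS
      induction hut using Relation.ReflTransGen.head_induction_on with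
      | refl => exact Or.inl ⟨ht, hnZ huN huZ⟩
      | @head u w e _ ih =>
        have hwN := (G.E_nodes e).2
        have hwZ : w ∉ G.Anc Z := fun h => huZ (mem_anc_of_E e h)
        right
        refine ⟨.left, ?_, id⟩
        rcases ih hwZ hwN with hw | ⟨k', hw, hk'⟩
        · exact ⟨w, hw, .single (k := .left) e⟩
        · exact hstep (k' := .left) hw e (fun h => absurd h.1 hk') fun _ => hnZ hwN hwZ
    · exfalso
      induction hut using Relation.ReflTransGen.head_induction_on generalizing k with
      | refl => exact hnZ huN huZ (hSY hS ht)
      | @head u w e _ ih =>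
        exact ih (hstep (k' := .right) hS e (fun h => h.2.elim) fun _ => hnZ huN huZ)
          (fun h => huZ (mem_anc_of_E e h)) (G.E_nodes e).2
    · exact absurd ⟨huN, t, ht, hut⟩ huZ
  -- Colliders in `A` can always be passed, if necessary after replacing the walk from `X` by
  -- another one.
  have hout : ∀ {u w k k'}, S u k → u ∈ A → k.HeadRight → G.Edge k' u w → k'.HeadLeft →
      S w k' := by
    intro u w k k' hS hu hk e hk'
    by_cases huZ : u ∈ G.Anc Z
    · exact hstep hS e (fun _ => huZ) fun h => absurd ⟨hk, hk'⟩ h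
    rcases hfree hS hu with h | h | ⟨k'', h, hk''⟩
    · exact absurd h huZ
    · exact ⟨u, h, .single e⟩
    · exact hstep h e (fun h => absurd h.1 hk'') fun _ hZ => huZ ⟨hAN hu, u, hZ, .refl⟩
  -- One side of the partition is what open walks from `X \ Z` reach, the other side is the rest.
  let R : Set V := {a | a ∈ X \ Z ∨ ∃ k, S a k}
  refine ⟨(A \ Z) ∩ R, (A \ Z) \ R, ?_, ?_, inter_union_sdiff _ _,
    disjoint_left.2 fun x hx hx' => hx'.2 hx.2, ?_⟩
  · intro x hx
    by_cases hxZ : x ∈ Z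
    · exact Or.inr hxZ
    · exact Or.inl ⟨⟨hXA hx, hxZ⟩, Or.inl ⟨hx, hxZ⟩⟩
  · intro y hy
    by_cases hyZ : y ∈ Z
    · exact Or.inr hyZ
    · refine Or.inl ⟨⟨hYA hy, hyZ⟩, ?_⟩
      rintro (hyX | ⟨k, hk⟩)
      · rcases h y hyX.1 y hy (.nil y (hY hy)) with h | h | h
        · exact hyZ h
        · exact hyZ h
        · exact h
      · exact hyZ (hSY hk hy)
  · rintro x ⟨⟨hxA, hxZ⟩, hxR⟩ y ⟨⟨hyA, hyZ⟩, hyR⟩ hadj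
    obtain ⟨k, hk⟩ := exists_openWalk_of_adj hAN hadj
    refine hyR (Or.inr ⟨k, ?_⟩)
    clear hadj hyR hyA hyZ
    induction hk with
    | @single u k e =>
      rcases hxR with hx | ⟨k', hx⟩
      · exact ⟨x, hx, .single e⟩
      · by_cases hc : k'.HeadRight ∧ k.HeadLeft
        · exact hout hx hxA hc.1 e hc.2
        · exact hstep hx e (fun h => absurd h hc) fun _ => hxZ
    | @snoc u w k k' _ e hC hN ih =>
      by_cases hc : k.HeadRight ∧ k'.HeadLeft
      · exact hout ih (hAA (hC hc)) hc.1 e hc.2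
      · refine hstep ih e (fun h => absurd h hc) fun _ huZ => hN hc ?_
        exact hA ▸ ⟨hZ huZ, u, Or.inr huZ, .refl⟩

end HEDG

/-! ### Consequences of the semi-graphoid axioms -/

namespace IsSemigraphoid

variable {V : Type*} {I : Set V → Set V → Set V → Prop}

theorem mono_right (hI : IsSemigraphoid I) {X Y Y' Z : Set V} (h : I X Y' Z) (hY : Y ⊆ Y') : I X Y Z :=
  hI.decomposition X Y Y' Z (by rwa [union_eq_self_of_subset_left hY])

theorem union_right (hI : IsSemigraphoid I) {X Y Z : Set V} (h : I X Y Z) : I X (Y ∪ Z) Z :=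
  hI.contraction X Y Z Z (by rwa [union_self]) (hI.irrelevance X Z)

theorem mono_union (hI : IsSemigraphoid I) {X Y X' Y' Z : Set V} (h : I X' Y' Z) (hX : X ⊆ X' ∪ Z) (hY : Y ⊆ Y' ∪ Z) :
    I X Y Z :=
  hI.symmetry _ _ _ (hI.mono_right (hI.union_right (hI.symmetry _ _ _
    (hI.mono_right (hI.union_right h) hY))) hX)

theorem weak_union_of_subset (hI : IsSemigraphoid I) {X Y B W A : Set V} (h : I X A B) (hA : A = Y ∪ W) (hB : B ⊆ W) :
    I X Y W := by
  have := hI.weak_union X Y W B (hA ▸ h)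
  rwa [union_eq_self_of_subset_right hB] at this

end IsSemigraphoid

/-! ### From the ordered local to the global Markov property -/

namespace HEDG

variable {V : Type*} {G : HEDG V}

theorem anc_subset_union_of_marg {U A : Set V} (hA : (G.marg U).IsAncestral A) :
    G.Anc A ⊆ A ∪ U := by
  rintro x ⟨hx, a, ha, hxa⟩
  by_cases hxU : x ∈ U
  · exact Or.inr hxU
  · refine Or.inl (hA.2.subset ⟨⟨hx, hxU⟩, a, ha, reflTransGen_marg hxa hxU (hA.1 ha).2⟩)

/-- The sub-HEDG on an ancestral set of a marginalization is itself a marginalization. -/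
theorem IsAncestral.sub_marg_eq_onto {U A : Set V} (hA : (G.marg U).IsAncestral A) :
    (G.marg U).sub A = G.onto A :=
  HEDG.sub_marg_eq_onto hA.1 (anc_subset_union_of_marg hA)

theorem blanket_subset_of_not_adj {A Y W : Set V} {v : V} (hA : A ⊆ G.nodes)
    (hXYW : A \ {v} ⊆ Y ∪ W) (h : ∀ y ∈ Y, ¬ (G.onto A).moral.Adj v y) :
    (G.onto A).blanket v ⊆ W := by
  intro w hw
  have hwA : w ∈ A := by
    have := hw.2.2.1
    rwa [onto_nodes hA] at this
  exact (hXYW ⟨hwA, fun e => hw.1 e.symm⟩).resolve_left fun hwY => h w hwY hw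

section Order

variable [LinearOrder V]

theorem isAncestral_pred {A : Set V} {v : V} (hA : A ⊆ G.nodes) (hle : ∀ a ∈ A, a ≤ v)
    (h : ∀ x ∈ G.Anc A, x ≤ v → x ∈ A) : (G.pred v).IsAncestral A := by
  have hA' : A ⊆ (G.pred v).nodes := fun x hx => ⟨hA hx, not_lt.2 (hle x hx)⟩
  refine ⟨hA', Subset.antisymm ?_ fun x hx => ⟨hA' hx, x, hx, .refl⟩⟩
  rintro x ⟨hx, a, ha, hxa⟩
  exact h x ⟨hx.1, a, ha, reflTransGen_of_marg hxa⟩ (not_lt.1 hx.2)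

/-- The ordered local Markov property for a perfect elimination order implies independence for
separations in the moralization. -/
theorem OLMP.of_separation [Finite V] {I : Set V → Set V → Set V → Prop} (hI : IsSemigraphoid I)
    (hP : G.IsPerfectElimination) (hO : G.OLMP I) (A : Set V) (hA : A ⊆ G.nodes)
    (hanc : ∀ x ∈ G.Anc A, (∃ a ∈ A, x ≤ a) → x ∈ A) (X Y Z : Set V)
    (hXYZ : X ∪ Y ∪ Z = A) (hXY : Disjoint X Y) (hXZ : Disjoint X Z) (hYZ : Disjoint Y Z)
    (hsep : ∀ x ∈ X, ∀ y ∈ Y, ¬ (G.onto A).moral.Adj x y) : I X Y Z := by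
  -- The closure `hanc` only concerns ancestors below some element of `A`: unlike being ancestral in
  -- `G`, it survives deletion of the largest element.
  induction A using WellFoundedLT.induction generalizing X Y Z with
  | ind A ih =>
  rcases A.eq_empty_or_nonempty with hA0 | hne
  · have h0 : ∀ B ⊆ A, B = ∅ := fun B hB => subset_empty_iff.1 (hA0 ▸ hB)
    rw [h0 Y fun y hy => hXYZ ▸ Or.inl (Or.inr hy), h0 Z fun z hz => hXYZ ▸ Or.inr hz]
    exact hI.irrelevance _ _
  obtain ⟨v, hvA, hmax⟩ := Set.exists_max_image A id A.toFinite hne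
  have hle : ∀ a ∈ A, a ≤ v := hmax
  have hpred : (G.pred v).IsAncestral A :=
    isAncestral_pred hA hle fun x hx hxv => hanc x hx ⟨v, hvA, hxv⟩
  have hcl := hP v (hA hvA) A hpred hvA
  have hind := hO v (hA hvA) A hpred hvA
  rw [show (G.pred v).sub A = G.onto A from hpred.sub_marg_eq_onto] at hcl hind
  set M := (G.onto A).moral with hM
  have hcomplete : ∀ x y, M.Adj v x → M.Adj v y → x ≠ y → M.Adj x y := fun x y hx hy hxy =>
    hcl (Or.inl hx) (Or.inl hy) hxy
  have hlt : A \ {v} < A := ⟨sdiff_subset, fun h => (h hvA).2 rfl⟩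
  have hanc' : ∀ x ∈ G.Anc (A \ {v}), (∃ a ∈ A \ {v}, x ≤ a) → x ∈ A \ {v} := by
    rintro x hx ⟨a, ha, hxa⟩
    refine ⟨hanc x (anc_mono sdiff_subset hx) ⟨a, ha.1, hxa⟩, ?_⟩
    rintro rfl
    exact ha.2 (le_antisymm (hle a ha.1) hxa)
  have hmem : ∀ x, x ∈ A ↔ (x ∈ X ∨ x ∈ Y) ∨ x ∈ Z := fun x => by rw [← hXYZ]; rfl
  rw [disjoint_left] at hXY hXZ hYZ
  -- A new adjacency would join two neighbours of `v`, which completeness makes adjacent already.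
  have hsep' : ∀ x ∈ X, ∀ y ∈ Y, ¬ (G.onto (A \ {v})).moral.Adj x y := by
    intro x hx y hy h
    rcases adj_or_adj_of_adj_sdiff hA hvA h with h | ⟨h1, h2⟩
    · exact hsep x hx y hy h
    · exact hsep x hx y hy (hcomplete x y h1 h2 h.1)
  have hIH : ∀ X' ⊆ X, ∀ Y' ⊆ Y, ∀ Z' ⊆ Z, X' ∪ Y' ∪ Z' = A \ {v} → I X' Y' Z' := by
    intro X' hX' Y' hY' Z' hZ' hu
    exact ih (A \ {v}) hlt (sdiff_subset.trans hA) hanc' X' Y' Z' hu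
      (disjoint_left.2 fun x h1 h2 => hXY (hX' h1) (hY' h2))
      (disjoint_left.2 fun x h1 h2 => hXZ (hX' h1) (hZ' h2))
      (disjoint_left.2 fun x h1 h2 => hYZ (hY' h1) (hZ' h2))
      fun x hx y hy => hsep' x (hX' hx) y (hY' hy)
  -- The blanket of `v` avoids `Y`, so weak union applied to oLMP separates `v` from `Y`, and
  -- contraction adds `v` to `X \ {v}`.
  have hvX : ∀ X Y : Set V, v ∈ X → (∀ x, x ∈ A ↔ (x ∈ X ∨ x ∈ Y) ∨ x ∈ Z) →
      (∀ x ∈ X, x ∉ Y) → (∀ x ∈ X, x ∉ Z) → (∀ x ∈ X, ∀ y ∈ Y, ¬ M.Adj x y) →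
      I (X \ {v}) Y Z → I X Y Z := by
    intro X Y hv hmem hXY hXZ hsep h
    have e1 : A \ {v} = Y ∪ ((X \ {v}) ∪ Z) := by
      ext x
      have := hmem x
      have := hXY v hv
      have := hXZ v hv
      simp only [mem_sdiff, mem_singleton_iff, mem_union]
      grind
    have h1 : I {v} Y ((X \ {v}) ∪ Z) := hI.weak_union_of_subset hind e1
      (blanket_subset_of_not_adj hA e1.subset fun y hy => hsep v hv y hy)
    have h2 := hI.contraction _ _ _ _ (hI.symmetry _ _ _ h1) (hI.symmetry _ _ _ h)
    rw [union_sdiff_cancel (singleton_subset_iff.2 hv)] at h2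
    exact hI.symmetry _ _ _ h2
  have hvZ : ∀ X Y : Set V, v ∈ Z → (∀ x, x ∈ A ↔ (x ∈ X ∨ x ∈ Y) ∨ x ∈ Z) →
      (∀ x ∈ X, x ∉ Z) → (∀ x ∈ Y, x ∉ Z) → (∀ y ∈ Y, ¬ M.Adj v y) →
      I X Y (Z \ {v}) → I X Y Z := by
    intro X Y hv hmem hXZ hYZ hsep h
    have e1 : A \ {v} = Y ∪ (X ∪ (Z \ {v})) := by
      ext x
      have := hmem x
      have : v ∉ X := fun h => hXZ v h hv
      have : v ∉ Y := fun h => hYZ v h hv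
      simp only [mem_sdiff, mem_singleton_iff, mem_union]
      grind
    have h1 : I {v} Y (X ∪ (Z \ {v})) := hI.weak_union_of_subset hind e1
      (blanket_subset_of_not_adj hA e1.subset hsep)
    have h2 := hI.contraction _ _ _ _ (hI.symmetry _ _ _ h1) (hI.symmetry _ _ _ h)
    rw [union_comm] at h2
    have h3 := hI.weak_union _ _ _ _ h2
    rw [union_sdiff_cancel (singleton_subset_iff.2 hv)] at h3
    exact hI.symmetry _ _ _ h3
  have hmem' : ∀ x, x ∈ A ↔ (x ∈ Y ∨ x ∈ X) ∨ x ∈ Z := fun x => by rw [hmem, or_comm (a := x ∈ Y)]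
  rcases (hmem v).1 hvA with (hv | hv) | hv
  · refine hvX X Y hv hmem (fun _ h => hXY h) (fun _ h => hXZ h) hsep
      (hIH _ sdiff_subset _ Subset.rfl _ Subset.rfl ?_)
    ext x
    have := hmem x
    have := hXY hv
    have := hXZ hv
    simp only [mem_sdiff, mem_singleton_iff, mem_union]
    grind
  · refine hI.symmetry _ _ _ (hvX Y X hv hmem' (fun _ h h' => hXY h' h) (fun _ h => hYZ h)
      (fun y hy x hx h => hsep x hx y hy h.symm)
      (hI.symmetry _ _ _ (hIH _ Subset.rfl _ sdiff_subset _ Subset.rfl ?_)))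
    ext x
    have := hmem x
    have : v ∉ X := fun h => hXY h hv
    have := hYZ hv
    simp only [mem_sdiff, mem_singleton_iff, mem_union]
    grind
  · have hIZ : I X Y (Z \ {v}) := by
      refine hIH _ Subset.rfl _ Subset.rfl _ sdiff_subset ?_
      ext x
      have := hmem x
      have : v ∉ X := fun h => hXZ h hv
      have : v ∉ Y := fun h => hYZ h hv
      simp only [mem_sdiff, mem_singleton_iff, mem_union]
      grind
    -- For `v ∈ Z`, completeness prevents `v` from having neighbours in both `X` and `Y`. The side
    -- without neighbours first takes part in an independence with `v` added to the other side; weak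
    -- union then moves `v` into the condition.
    by_cases hy : ∀ y ∈ Y, ¬ M.Adj v y
    · exact hvZ X Y hv hmem (fun _ h => hXZ h) (fun _ h => hYZ h) hy hIZ
    · push Not at hy
      obtain ⟨y, hy, hvy⟩ := hy
      refine hI.symmetry _ _ _ (hvZ Y X hv hmem' (fun _ h => hYZ h) (fun _ h => hXZ h) ?_
        (hI.symmetry _ _ _ hIZ))
      intro x hx hvx
      exact hsep x hx y hy (hcomplete x y hvx hvy fun e => hXY hx (e ▸ hy))

theorem OLMP.dGMP [Finite V] {I : Set V → Set V → Set V → Prop} (hI : IsSemigraphoid I)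
    (hP : G.IsPerfectElimination) (hO : G.OLMP I) : G.DGMP I := by
  intro X Y Z hX hY hZ h
  obtain ⟨X', Y', hXX', hYY', hu, hd, hsep⟩ := h.exists_partition hX hY hZ rfl
  have hZA : Z ⊆ G.Anc (X ∪ Y ∪ Z) := fun z hz => ⟨hZ hz, z, Or.inr hz, .refl⟩
  have hmem : ∀ x ∈ X' ∪ Y', x ∉ Z := fun x hx => by
    rw [hu] at hx
    exact hx.2
  refine hI.mono_union (hO.of_separation hI hP (G.Anc (X ∪ Y ∪ Z)) (fun x hx => hx.1) ?_ X' Y' Z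
    ?_ hd (disjoint_left.2 fun x hx => hmem x (Or.inl hx))
    (disjoint_left.2 fun x hx => hmem x (Or.inr hx)) hsep) hXX' hYY'
  · rintro x ⟨-, b, hb, hxb⟩ -
    exact mem_anc_of_reflTransGen hxb hb
  · rw [hu, sdiff_union_of_subset hZA]

end Order

/-! ### From the global property back to the local ones -/

theorem DGMP.dLMP {I : Set V → Set V → Set V → Prop} (hD : G.DGMP I) : G.DLMP I := by
  intro v hv A hA _ hvA S hS
  rw [marg_sub_eq_onto hA.1 hA.2.subset]
  have hAS : A \ S ⊆ G.nodes := sdiff_subset.trans hA.1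
  refine hD _ _ _ (singleton_subset_iff.2 hv) (sdiff_subset.trans hAS) (fun w hw => ?_)
    (dSep_blanket hAS ⟨hvA, fun h => (hS h).2 rfl⟩)
  have := hw.2.2.1
  rw [onto_nodes hAS] at this
  exact hAS this

section Order

variable [LinearOrder V]

/-- The set `A` equals `G.Anc A` minus the nodes of `G.Sc v` after `v`, so the required independence
is the instance of dLMP for `G.Anc A` and these nodes. -/
theorem DLMP.oLMP {I : Set V → Set V → Set V → Prop} (ha : G.IsAssembling)
    (hp : G.IsPseudoTopological) (hD : G.DLMP I) : G.OLMP I := by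
  intro v hv A hA hvA
  rw [show (G.pred v).sub A = G.onto A from hA.sub_marg_eq_onto]
  have hAN : A ⊆ G.nodes := fun x hx => (hA.1 hx).1
  have hle : ∀ a ∈ A, a ≤ v := fun a ha => not_lt.1 (hA.1 ha).2
  have hsc : ∀ {x y}, x ∈ G.Sc y → y ∈ G.nodes → y ∈ G.Sc x := by
    rintro x y ⟨⟨hx, _, rfl, h1⟩, ⟨-, _, rfl, h2⟩⟩ hy
    exact ⟨⟨hy, x, rfl, h2⟩, ⟨hy, x, rfl, h1⟩⟩
  have hanc := anc_subset_union_of_marg (G := G) (U := {w | v < w}) hA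
  have hsub : A ⊆ G.Anc A := fun x hx => ⟨hAN hx, x, hx, .refl⟩
  let S : Set V := {w | w ∈ G.Sc v ∧ v < w}
  have hancS : G.Anc A ⊆ A ∪ S := by
    intro x hx
    rcases hanc hx with h | h
    · exact Or.inl h
    right
    obtain ⟨hxN, a, haA, hxa⟩ := hx
    have hax : a ≤ x := (hle a haA).trans (le_of_lt h)
    -- An ancestor of `a` not before `a` is strongly connected to it. As `a ≤ v ≤ x`, the assembling
    -- property places `v` in the same component.
    have hxSc : x ∈ G.Sc a := by
      by_contra hx
      exact absurd (hp a (hAN haA) x ⟨⟨hxN, a, rfl, hxa⟩, hx⟩) (not_lt.2 hax)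
    have hvSc := ha a (hAN haA) x hxN v hv hxSc (hle a haA) (le_of_lt h)
    obtain ⟨⟨-, _, rfl, h1⟩, ⟨-, _, rfl, h2⟩⟩ := hvSc
    obtain ⟨⟨-, _, rfl, h3⟩, ⟨-, _, rfl, h4⟩⟩ := hxSc
    exact ⟨⟨⟨hxN, v, rfl, h3.trans h2⟩, ⟨hxN, v, rfl, h1.trans h4⟩⟩, h⟩
  have hAS : G.Anc A \ S = A := by
    ext x
    exact ⟨fun h => (hancS h.1).resolve_right h.2,
      fun h => ⟨hsub h, fun h' => absurd h'.2 (not_lt.2 (hle x h))⟩⟩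
  have hancN : G.Anc A ⊆ G.nodes := fun x hx => hx.1
  have hanc2 : G.Anc (G.Anc A) = G.Anc A := by
    refine Subset.antisymm ?_ fun x hx => ⟨hx.1, x, hx, .refl⟩
    rintro x ⟨-, b, hb, hxb⟩
    exact mem_anc_of_reflTransGen hxb hb
  have key := hD v hv (G.Anc A) ⟨hancN, hanc2⟩ ?_ (hsub hvA) S ?_
  · rwa [marg_sub_eq_onto hancN hanc2.subset, hAS] at key
  · intro x hx
    by_cases hxd : x ∈ G.Desc {v}
    · right
      rcases hancS hx with h | h
      · have hvx : v ∈ G.Sc x := by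
          by_contra hvx
          obtain ⟨-, _, rfl, hd⟩ := hxd
          exact absurd (hp x hx.1 _ ⟨⟨hv, x, rfl, hd⟩, hvx⟩) (not_lt.2 (hle x h))
        exact hsc hvx hx.1
      · exact h.1
    · exact Or.inl ⟨hx.1, hxd⟩
  · rintro x ⟨h1, h2⟩
    exact ⟨h1, fun h => absurd h (ne_of_gt h2)⟩

/-! ### Topological orders -/

theorem IsTopological.lt_of_dirVia (h : G.IsTopological) {U : Set V} {x y : V}
    (hxy : G.DirVia U x y) : x < y := by
  have hE : ∀ {a b}, G.E a b → a < b := fun e => h _ (G.E_nodes e).2 _ ⟨_, rfl, e⟩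
  obtain ⟨t, ht, e⟩ := hxy
  refine lt_of_le_of_lt ?_ (hE e)
  clear e
  induction ht with
  | refl => exact le_rfl
  | tail _ e ih => exact ih.trans (le_of_lt (hE e.1))

theorem IsTopological.le_of_reflTransGen (h : G.IsTopological) {x y : V}
    (hxy : Relation.ReflTransGen G.E x y) : x ≤ y := by
  induction hxy with
  | refl => exact le_rfl
  | tail _ e ih => exact ih.trans (le_of_lt (h.lt_of_dirVia (.of_E (U := ∅) e)))

theorem IsTopological.isAssembling (h : G.IsTopological) :
    G.IsAssembling := by
  rintro v hv v' - w - ⟨⟨-, _, rfl, h1⟩, -⟩ hvw hwv'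
  obtain rfl := le_antisymm (hwv'.trans (h.le_of_reflTransGen h1)) hvw
  exact ⟨⟨hv, _, rfl, .refl⟩, ⟨hv, _, rfl, .refl⟩⟩

theorem IsTopological.isPseudoTopological (h : G.IsTopological) : G.IsPseudoTopological := by
  rintro v hv w ⟨⟨hw, _, rfl, h1⟩, h2⟩
  refine lt_of_le_of_ne (h.le_of_reflTransGen h1) ?_
  rintro rfl
  exact h2 ⟨⟨hv, _, rfl, .refl⟩, ⟨hv, _, rfl, .refl⟩⟩

/-- The last node `v` has no children among its predecessors. So each neighbour lies in the district
of `v` or is a parent of a node in it, and two neighbours are linked through this one district. -/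
theorem IsTopological.isPerfectElimination (h : G.IsTopological) : G.IsPerfectElimination := by
  intro v hv A hA hvA
  have key : ∀ x ∈ ((G.pred v).sub A).blanket v ∪ {v}, x ∈ ((G.pred v).sub A).nodes ∧
      ∃ b, (x = b ∨ ((G.pred v).sub A).E x b) ∧
        Relation.ReflTransGen ((G.pred v).sub A).Bidir v b := by
    rintro x (⟨-, -, hx, a, b, ha, hb, hab⟩ | rfl)
    · rcases ha with rfl | ha
      · exact ⟨hx, b, hb, hab⟩
      · exact absurd (h.lt_of_dirVia ha.1.2.2) ha.1.2.1.2
    · exact ⟨⟨hA.1 hvA, hvA⟩, x, Or.inl rfl, .refl⟩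
  intro x hx y hy hne
  obtain ⟨hxN, a, ha, hva⟩ := key x hx
  obtain ⟨hyN, b, hb, hvb⟩ := key y hy
  exact ⟨hne, hxN, hyN, a, b, ha, hb, (reflTransGen_bidir_symm hva).trans hvb⟩

/-- The relations between the Markov properties for a semi-graphoid. -/
theorem oLMP_iff_dLMP_and_dLMP_iff_dGMP [Finite V] {I : Set V → Set V → Set V → Prop}
    (hI : IsSemigraphoid I) (ha : G.IsAssembling) (hq : G.IsQuasiTopological) :
    (G.OLMP I ↔ G.DLMP I) ∧ (G.DLMP I ↔ G.DGMP I) := by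
  have h1 : G.OLMP I → G.DGMP I := fun h => h.dGMP hI hq.2
  have h2 : G.DGMP I → G.DLMP I := fun h => h.dLMP
  have h3 : G.DLMP I → G.OLMP I := fun h => h.oLMP ha hq.1
  exact ⟨⟨h2 ∘ h1, h3⟩, ⟨h1 ∘ h3, h2⟩⟩

end Order

end HEDG

theorem mainTheorem4 {V : Type*} [Finite V] [LinearOrder V] (G : HEDG V)
    (hG : G.nodes = Set.univ) {𝓧 : V → Type*} [∀ v, MeasurableSpace (𝓧 v)]
    [∀ v, StandardBorelSpace (𝓧 v)] (P : Measure (∀ v, 𝓧 v)) [IsProbabilityMeasure P] :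
    (G.IsPerfectElimination → G.OLMP (CondIndepCoord P) → G.DGMP (CondIndepCoord P)) ∧
    (G.IsAssembling → G.IsQuasiTopological →
      (G.OLMP (CondIndepCoord P) ↔ G.DLMP (CondIndepCoord P)) ∧
      (G.DLMP (CondIndepCoord P) ↔ G.DGMP (CondIndepCoord P))) ∧
    (G.IsTopological → G.IsAssembling ∧ G.IsQuasiTopological) ∧
    (∀ I : Set V → Set V → Set V → Prop, IsSemigraphoid I →
      (G.IsPerfectElimination → G.OLMP I → G.DGMP I) ∧
      (G.IsAssembling → G.IsQuasiTopological →
        (G.OLMP I ↔ G.DLMP I) ∧ (G.DLMP I ↔ G.DGMP I))) := by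
  have hI := isSemigraphoid_condIndepCoord P
  exact ⟨fun hP hO => hO.dGMP hI hP,
    fun ha hq => HEDG.oLMP_iff_dLMP_and_dLMP_iff_dGMP hI ha hq,
    fun h => ⟨h.isAssembling, h.isPseudoTopological, h.isPerfectElimination⟩,
    fun I hI => ⟨fun hP hO => hO.dGMP hI hP,
      fun ha hq => HEDG.oLMP_iff_dLMP_and_dLMP_iff_dGMP hI ha hq⟩⟩
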